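/- A JB$^*$-algebra is a complex Banach space $\mathcal{M}$ with a commutative Jordan product $\circ$ and a conjugate-linear multiplicative involution $*$ such that $\|x\circ y\|\le\|x\|\,\|y\|$, $\|x^*\|=\|x\|$ and $\|\{x,x^*,x\}\|=\|x\|^3$, where $\{x,y,z\}=(x\circ y)\circ z+(y\circ z)\circ x-(x\circ z)\circ y$. A JBW$^*$-algebra is a JB$^*$-algebra which is a dual Banach space; $\mathcal{M}_*$ denotes its predual, viewed as a closed subspace of the dual $\mathcal{M}^*$. A sub-JBW$^*$-algebra $\mathcal{N}$ of $\mathcal{M}$ is a weak* closed Jordan $*$-subalgebra; its predual $\mathcal{N}_*$ consists of the restrictions to $\mathcal{N}$ of the elements of $\mathcal{M}_*$. A normal faithful state on $\mathcal{M}$ is an element $\varphi\in\mathcal{M}_*$ of norm $1$ with $\varphi(x)\geq 0$ for each positive $x$ (that is, $x=y\circ y$ with $y=y^*$) and $\varphi(x)\neq 0$ if moreover $x\neq 0$. Given such a $\varphi$, the couple $(\mathcal{M},\mathcal{M}_*)$ is made compatible by the embedding $\mathcal{M}\to\mathcal{M}_*$, $x\mapsto\varphi_x$, where $\varphi_x(y)=\varphi(x\circ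 y)$. One sets $\mathrm{L}^1(\mathcal{M},\varphi)=\mathcal{M}_*$ and, for $1<p<\infty$, $\mathrm{L}^p(\mathcal{M},\varphi)=(\mathcal{M},\mathcal{M}_*)_{1/p}$ (complex interpolation). These spaces contain $\mathcal{M}$. Proposition. Let $\mathcal{M}$ be a JBW$^*$-algebra equipped with a normal faithful state $\varphi$. (1) Let $\alpha$ be a $*$-automorphism of $\mathcal{M}$ with $\varphi\circ\alpha=\varphi$. Then, for each $1\le p<\infty$, $\alpha$ extends to a surjective linear isometry $\alpha_p\colon\mathrm{L}^p(\mathcal{M},\varphi)\to\mathrm{L}^p(\mathcal{M},\varphi)$. (2) Let $\mathbb{E}\colon\mathcal{M}\to\mathcal{M}$ be a normal (weak* continuous) contractive linear projection onto a sub-JBW$^*$-algebra $\mathcal{N}$ with $\varphi\circ\mathbb{E}=\varphi$. Then, for each $1\le p<\infty$, $\mathbb{E}$ extends to a bounded linear projection $\mathbb{E}_p\colon\mathrm{L}^p(\mathcal{M},\varphi)\to\mathrm{L}^p(\mathcal{M},\varphi)$ whose range is linearly isometric to $\mathrm{L}^p(\mathcal{N},\varphi|_{\mathcal{N}})$. 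-/

import Mathlib

open scoped ZeroAtInfty Topology

noncomputable section

/-! ### Normed subspaces with their own norm -/

/-- A linear subspace of a complex vector space `V`, equipped with a norm of its own
(which need not be the restriction of a norm of `V`). -/
structure NormedSub (V : Type*) [AddCommGroup V] [Module ℂ V] where
  carrier : Submodule ℂ V
  nrm : Seminorm ℂ carrier
  definite : ∀ x, nrm x = 0 → x = 0

namespace NormedSub

variable {V : Type*} [AddCommGroup V] [Module ℂ V]

/-- The normed space underlying a `NormedSub`. -/
def Elem (W : NormedSub V) : Type _ := W.carrier

/-- The inclusion of a `NormedSub` in the surrounding vector space. -/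
def val {W : NormedSub V} (x : W.Elem) : V := Subtype.val (p := (· ∈ W.carrier)) x

instance (W : NormedSub V) : AddCommGroup W.Elem := inferInstanceAs (AddCommGroup W.carrier)

instance (W : NormedSub V) : Module ℂ W.Elem := inferInstanceAs (Module ℂ W.carrier)

instance (W : NormedSub V) : NormedAddCommGroup W.Elem :=
  AddGroupNorm.toNormedAddCommGroup
    { toFun := fun x => W.nrm x
      map_zero' := map_zero W.nrm
      add_le' := fun x y => map_add_le_add W.nrm x y
      neg' := fun x => map_neg_eq_map W.nrm x
      eq_zero_of_map_eq_zero' := W.definite }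

instance (W : NormedSub V) : NormedSpace ℂ W.Elem where
  norm_smul_le c x := (map_smul_eq_mul W.nrm c x).le

end NormedSub

/-! ### Complex interpolation -/

namespace Interp

variable {X₀ X₁ V : Type*} [NormedAddCommGroup X₀] [NormedSpace ℂ X₀]
  [NormedAddCommGroup X₁] [NormedSpace ℂ X₁] [NormedAddCommGroup V] [NormedSpace ℂ V]

/-- The map `(x₀, x₁) ↦ j₀ x₀ + j₁ x₁`, on the `ℓ¹`-direct sum of `X₀` and `X₁`. -/
def sumMap (j₀ : X₀ →L[ℂ] V) (j₁ : X₁ →L[ℂ] V) : WithLp 1 (X₀ × X₁) →L[ℂ] V :=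
  (j₀.coprod j₁).comp (WithLp.prodContinuousLinearEquiv 1 ℂ X₀ X₁).toContinuousLinearMap

/-- The sum `X₀ + X₁` inside `V` (`X₀`, `X₁` being embedded by `j₀`, `j₁`), realised as the
quotient of the `ℓ¹`-direct sum by the kernel of `(x₀, x₁) ↦ j₀ x₀ + j₁ x₁`. The quotient norm
is `‖x‖ = inf {‖x₀‖ + ‖x₁‖ : x = j₀ x₀ + j₁ x₁}`. -/
abbrev Sum (j₀ : X₀ →L[ℂ] V) (j₁ : X₁ →L[ℂ] V) : Type _ :=
  WithLp 1 (X₀ × X₁) ⧸ (sumMap j₀ j₁).ker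

instance (j₀ : X₀ →L[ℂ] V) (j₁ : X₁ →L[ℂ] V) :
    IsClosed ((sumMap j₀ j₁).ker : Set (WithLp 1 (X₀ × X₁))) :=
  (sumMap j₀ j₁).isClosed_ker

variable (j₀ : X₀ →L[ℂ] V) (j₁ : X₁ →L[ℂ] V)

/-- The embedding of `X₀` in `X₀ + X₁`. -/
def inl : X₀ →ₗ[ℂ] Sum j₀ j₁ :=
  (sumMap j₀ j₁).ker.mkQ ∘ₗ (WithLp.linearEquiv 1 ℂ (X₀ × X₁)).symm.toLinearMap ∘ₗ
    LinearMap.inl ℂ X₀ X₁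

/-- The embedding of `X₁` in `X₀ + X₁`. -/
def inr : X₁ →ₗ[ℂ] Sum j₀ j₁ :=
  (sumMap j₀ j₁).ker.mkQ ∘ₗ (WithLp.linearEquiv 1 ℂ (X₀ × X₁)).symm.toLinearMap ∘ₗ
    LinearMap.inr ℂ X₀ X₁

/-- The functions `f` of the Calderón family: bounded and continuous on the closed
strip with values in `X₀ + X₁`, holomorphic on the open strip, with boundary values
`g₀ t = f (i t)` and `g₁ t = f (1 + i t)` that are continuous and vanish at infinity in `X₀` and
in `X₁`, respectively. -/
structure IsAdmissible (f : ℂ → Sum j₀ j₁) (g₀ : C₀(ℝ, X₀)) (g₁ : C₀(ℝ, X₁)) : Prop where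
  continuousOn : ContinuousOn f {z | 0 ≤ z.re ∧ z.re ≤ 1}
  bounded : ∃ C : ℝ, ∀ z : ℂ, 0 ≤ z.re ∧ z.re ≤ 1 → ‖f z‖ ≤ C
  holomorphic : DifferentiableOn ℂ f {z | 0 < z.re ∧ z.re < 1}
  left : ∀ t : ℝ, f (t * Complex.I) = inl j₀ j₁ (g₀ t)
  right : ∀ t : ℝ, f (1 + t * Complex.I) = inr j₀ j₁ (g₁ t)

variable {j₀ j₁}

theorem norm_inl_le (x : X₀) : ‖inl j₀ j₁ x‖ ≤ ‖x‖ := by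
  refine (Submodule.Quotient.norm_mk_le _ _).trans ?_
  simp

theorem norm_inr_le (x : X₁) : ‖inr j₀ j₁ x‖ ≤ ‖x‖ := by
  refine (Submodule.Quotient.norm_mk_le _ _).trans ?_
  simp

theorem inr_injective (h : Function.Injective j₁) : Function.Injective (inr j₀ j₁) := by
  rw [← LinearMap.ker_eq_bot, LinearMap.ker_eq_bot']
  intro x hx
  have h2 := (Submodule.Quotient.mk_eq_zero _).1 hx
  apply h
  simpa [sumMap] using h2

namespace IsAdmissible

theorem zero : IsAdmissible j₀ j₁ (0 : ℂ → Sum j₀ j₁) 0 0 where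
  continuousOn := continuousOn_const
  bounded := ⟨0, by simp⟩
  holomorphic := differentiableOn_const 0
  left := by simp
  right := by simp

theorem add {f f' : ℂ → Sum j₀ j₁} {g₀ g₀' : C₀(ℝ, X₀)} {g₁ g₁' : C₀(ℝ, X₁)}
    (h : IsAdmissible j₀ j₁ f g₀ g₁) (h' : IsAdmissible j₀ j₁ f' g₀' g₁') :
    IsAdmissible j₀ j₁ (f + f') (g₀ + g₀') (g₁ + g₁') where
  continuousOn := h.continuousOn.add h'.continuousOn
  bounded := by
    obtain ⟨C, hC⟩ := h.bounded
    obtain ⟨C', hC'⟩ := h'.bounded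
    exact ⟨C + C', fun z hz => (norm_add_le _ _).trans (add_le_add (hC z hz) (hC' z hz))⟩
  holomorphic := h.holomorphic.add h'.holomorphic
  left t := by simp [h.left, h'.left]
  right t := by simp [h.right, h'.right]

theorem smul (c : ℂ) {f : ℂ → Sum j₀ j₁} {g₀ : C₀(ℝ, X₀)} {g₁ : C₀(ℝ, X₁)}
    (h : IsAdmissible j₀ j₁ f g₀ g₁) : IsAdmissible j₀ j₁ (c • f) (c • g₀) (c • g₁) where
  continuousOn := h.continuousOn.const_smul c
  bounded := by
    obtain ⟨C, hC⟩ := h.bounded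
    exact ⟨‖c‖ * C, fun z hz => by
      simpa [norm_smul] using mul_le_mul_of_nonneg_left (hC z hz) (norm_nonneg c)⟩
  holomorphic := h.holomorphic.const_smul c
  left t := by simp [h.left]
  right t := by simp [h.right]

theorem norm_le {f : ℂ → Sum j₀ j₁} {g₀ : C₀(ℝ, X₀)} {g₁ : C₀(ℝ, X₁)}
    (h : IsAdmissible j₀ j₁ f g₀ g₁) (θ : unitInterval) :
    ‖f ((θ : ℝ) : ℂ)‖ ≤ max ‖g₀‖ ‖g₁‖ := by
  obtain ⟨C, hC⟩ := h.bounded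
  have hcl : closure (Complex.re ⁻¹' Set.Ioo (0 : ℝ) 1) ⊆ {z | 0 ≤ z.re ∧ z.re ≤ 1} := by
    rw [Complex.closure_preimage_re, closure_Ioo (by norm_num)]
    exact fun z hz => hz
  refine PhragmenLindelof.vertical_strip (a := 0) (b := 1)
    ⟨h.holomorphic, h.continuousOn.mono hcl⟩ ⟨0, by positivity, 0, ?_⟩ ?_ ?_ ?_ ?_
  · simp only [zero_mul, Real.exp_zero]
    refine Asymptotics.IsBigO.of_bound C ?_
    refine Filter.Eventually.filter_mono inf_le_right ?_
    rw [Filter.eventually_principal]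
    intro z hz
    simpa using hC z ⟨hz.1.le, hz.2.le⟩
  · intro z hz
    have hz' : z = (z.im : ℂ) * Complex.I := by apply Complex.ext <;> simp [hz]
    rw [hz', h.left]
    exact (norm_inl_le _).trans ((g₀.toBCF.norm_coe_le_norm z.im).trans (le_max_left _ _))
  · intro z hz
    have hz' : z = 1 + (z.im : ℂ) * Complex.I := by apply Complex.ext <;> simp [hz]
    rw [hz', h.right]
    exact (norm_inr_le _).trans ((g₁.toBCF.norm_coe_le_norm z.im).trans (le_max_right _ _))
  · simpa using θ.2.1
  · simpa using θ.2.2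

end IsAdmissible

variable (j₀ j₁)

/-- The subspace `(X₀, X₁)_θ` of `X₀ + X₁`. -/
def space (θ : unitInterval) : Submodule ℂ (Sum j₀ j₁) where
  carrier := {x | ∃ f g₀ g₁, IsAdmissible j₀ j₁ f g₀ g₁ ∧ f ((θ : ℝ) : ℂ) = x}
  zero_mem' := ⟨0, 0, 0, IsAdmissible.zero, rfl⟩
  add_mem' := by
    rintro _ _ ⟨f, g₀, g₁, h, rfl⟩ ⟨f', g₀', g₁', h', rfl⟩
    exact ⟨_, _, _, h.add h', rfl⟩
  smul_mem' := by
    rintro c _ ⟨f, g₀, g₁, h, rfl⟩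
    exact ⟨_, _, _, h.smul c, rfl⟩

variable {j₀ j₁}

/-- The norms of the admissible functions `f` such that `f θ = x`. -/
def norms (θ : unitInterval) (x : Sum j₀ j₁) : Set ℝ :=
  {r | ∃ f g₀ g₁, IsAdmissible j₀ j₁ f g₀ g₁ ∧ f ((θ : ℝ) : ℂ) = x ∧
    r = max ‖g₀‖ ‖g₁‖}

/-- The interpolation norm of an element `x` of `(X₀, X₁)_θ`. -/
def interpNorm (θ : unitInterval) (x : Sum j₀ j₁) : ℝ := sInf (norms θ x)

theorem norms_bddBelow (θ : unitInterval) (x : Sum j₀ j₁) : BddBelow (norms θ x) :=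
  ⟨0, by rintro _ ⟨f, g₀, g₁, -, -, rfl⟩; positivity⟩

theorem norms_nonempty {θ : unitInterval} {x : Sum j₀ j₁} (hx : x ∈ space j₀ j₁ θ) :
    (norms θ x).Nonempty := by
  obtain ⟨f, g₀, g₁, h, hf⟩ := hx
  exact ⟨_, f, g₀, g₁, h, hf, rfl⟩

theorem norm_le_interpNorm {θ : unitInterval} {x : Sum j₀ j₁} (hx : x ∈ space j₀ j₁ θ) :
    ‖x‖ ≤ interpNorm θ x := by
  refine le_csInf (norms_nonempty hx) ?_
  rintro _ ⟨f, g₀, g₁, h, rfl, rfl⟩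
  exact h.norm_le θ

theorem interpNorm_add {θ : unitInterval} {x y : Sum j₀ j₁} (hx : x ∈ space j₀ j₁ θ)
    (hy : y ∈ space j₀ j₁ θ) : interpNorm θ (x + y) ≤ interpNorm θ x + interpNorm θ y := by
  refine le_of_forall_pos_le_add fun ε hε => ?_
  obtain ⟨_, ⟨f, g₀, g₁, h, hf, rfl⟩, hr⟩ :=
    Real.lt_sInf_add_pos (norms_nonempty hx) (half_pos hε)
  obtain ⟨_, ⟨f', g₀', g₁', h', hf', rfl⟩, hr'⟩ :=
    Real.lt_sInf_add_pos (norms_nonempty hy) (half_pos hε)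
  have h1 : interpNorm θ (x + y) ≤ max ‖g₀ + g₀'‖ ‖g₁ + g₁'‖ :=
    csInf_le (norms_bddBelow _ _) ⟨_, _, _, h.add h', by simp [hf, hf'], rfl⟩
  have h2 : max ‖g₀ + g₀'‖ ‖g₁ + g₁'‖ ≤ max ‖g₀‖ ‖g₁‖ + max ‖g₀'‖ ‖g₁'‖ :=
    max_le ((norm_add_le _ _).trans (add_le_add (le_max_left _ _) (le_max_left _ _)))
      ((norm_add_le _ _).trans (add_le_add (le_max_right _ _) (le_max_right _ _)))
  unfold interpNorm at *
  linarith

theorem interpNorm_smul_le {θ : unitInterval} {x : Sum j₀ j₁} (c : ℂ) (hx : x ∈ space j₀ j₁ θ) :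
    interpNorm θ (c • x) ≤ ‖c‖ * interpNorm θ x := by
  rw [interpNorm, interpNorm, ← smul_eq_mul, ← Real.sInf_smul_of_nonneg (norm_nonneg c)]
  refine le_csInf ((norms_nonempty hx).smul_set) ?_
  rintro _ ⟨_, ⟨f, g₀, g₁, h, hf, rfl⟩, rfl⟩
  refine csInf_le (norms_bddBelow _ _) ⟨_, _, _, h.smul c, by simp [hf], ?_⟩
  simp only [norm_smul, smul_eq_mul]
  exact (mul_max_of_nonneg _ _ (norm_nonneg c))

variable (j₀ j₁)

/-- The complex interpolation space `(X₀, X₁)_θ` with its norm. -/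
def interp (θ : unitInterval) : NormedSub (Sum j₀ j₁) where
  carrier := space j₀ j₁ θ
  nrm := Seminorm.ofSMulLE (fun x => interpNorm θ (x : Sum j₀ j₁))
    (by
      refine le_antisymm ?_ (le_trans (norm_nonneg (0 : Sum j₀ j₁)) (norm_le_interpNorm (Submodule.zero_mem _)))
      exact csInf_le (norms_bddBelow _ _) ⟨0, 0, 0, IsAdmissible.zero, rfl, by simp⟩)
    (fun x y => interpNorm_add x.2 y.2)
    (fun c x => interpNorm_smul_le c x.2)
  definite x hx := by
    have h := norm_le_interpNorm x.2
    have h2 : interpNorm θ (x : Sum j₀ j₁) = 0 := hx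
    rw [h2, norm_le_zero_iff] at h
    exact Subtype.ext h

/-- The space `X₁` with its own norm, as a subspace of `X₀ + X₁`. -/
def right (h : Function.Injective j₁) : NormedSub (Sum j₀ j₁) where
  carrier := LinearMap.range (inr j₀ j₁)
  nrm := (normSeminorm ℂ X₁).comp
    (LinearEquiv.ofInjective (inr j₀ j₁) (inr_injective h)).symm.toLinearMap
  definite x hx := by simpa using hx

end Interp

/-! ### JB*-algebras and JBW*-algebras -/

/-- A JB*-algebra, the Jordan product being written `x * y`. -/
class JBStarAlgebra (A : Type*) extends NormedAddCommGroup A, NonUnitalNonAssocCommRing A,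
    StarRing A, CompleteSpace A, NormedSpace ℂ A, IsScalarTower ℂ A A, SMulCommClass ℂ A A,
    StarModule ℂ A, IsCommJordan A where
  norm_jmul_le : ∀ x y : A, ‖x * y‖ ≤ ‖x‖ * ‖y‖
  norm_jstar : ∀ x : A, ‖star x‖ = ‖x‖
  /-- `‖{x, x*, x}‖ = ‖x‖³` where `{x, y, z} = (x ∘ y) ∘ z + (y ∘ z) ∘ x - (x ∘ z) ∘ y`. -/
  norm_triple : ∀ x : A,
    ‖(x * star x) * x + (star x * x) * x - (x * x) * star x‖ = ‖x‖ ^ 3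

section Predual

variable {X : Type*} [NormedAddCommGroup X] [NormedSpace ℂ X]

/-- A subspace of the dual of `X`, as a normed space with the norm of the dual. -/
def Pre (F : Submodule ℂ (StrongDual ℂ X)) : Type _ := F

instance (F : Submodule ℂ (StrongDual ℂ X)) : NormedAddCommGroup (Pre F) :=
  inferInstanceAs (NormedAddCommGroup F)

instance (F : Submodule ℂ (StrongDual ℂ X)) : NormedSpace ℂ (Pre F) :=
  inferInstanceAs (NormedSpace ℂ F)

/-- The inclusion of a subspace of the dual in the dual. -/
def Pre.toDual (F : Submodule ℂ (StrongDual ℂ X)) : Pre F →L[ℂ] StrongDual ℂ X :=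
  LinearMap.mkContinuous
    { toFun := fun ψ => Subtype.val (p := (· ∈ F)) ψ
      map_add' := fun _ _ => rfl
      map_smul' := fun _ _ => rfl } 1 (fun ψ => (one_mul ‖ψ‖).ge)

theorem Pre.toDual_injective (F : Submodule ℂ (StrongDual ℂ X)) :
    Function.Injective (Pre.toDual F) := Subtype.val_injective

/-- A closed subspace `F` of the dual of a Banach space `X` is a predual of `X` if the evaluation
map `X → F*`, `x ↦ (ψ ↦ ψ x)`, is isometric and onto. -/
structure IsPredual (F : Submodule ℂ (StrongDual ℂ X)) : Prop where
  isClosed : IsClosed (F : Set (StrongDual ℂ X))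
  isometry : ∀ x : X, ‖(Pre.toDual F).flip x‖ = ‖x‖
  surjective : Function.Surjective (Pre.toDual F).flip

/-- The weak* topology on `X` that is defined by a predual `F`. -/
abbrev weakStar (F : Submodule ℂ (StrongDual ℂ X)) : TopologicalSpace X :=
  TopologicalSpace.induced (fun x (ψ : F) => (ψ : StrongDual ℂ X) x) Pi.topologicalSpace

end Predual

section JB

variable {M : Type*} [JBStarAlgebra M]

/-- A normal faithful state (with respect to the predual `F`): an element `φ` of the predual of
norm one which is nonnegative on the positive elements, that is on the squares of the selfadjoint
elements, and which vanishes at no nonzero positive element. -/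
structure IsNormalFaithfulState (F : Submodule ℂ (StrongDual ℂ M)) (φ : StrongDual ℂ M) :
    Prop where
  normal : φ ∈ F
  norm_eq_one : ‖φ‖ = 1
  nonneg : ∀ y : M, IsSelfAdjoint y → 0 ≤ (φ (y * y)).re ∧ (φ (y * y)).im = 0
  faithful : ∀ y : M, IsSelfAdjoint y → φ (y * y) = 0 → y * y = 0

/-- The map `x ↦ φ_x`, where `φ_x y = φ (x ∘ y)`, with values in the dual of `M`. -/
def jtranslate (φ : StrongDual ℂ M) : M →L[ℂ] StrongDual ℂ M :=
  LinearMap.mkContinuous₂ ((LinearMap.mul ℂ M).compr₂ (φ : M →ₗ[ℂ] ℂ)) ‖φ‖ fun x y =>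
    (φ.le_opNorm _).trans (by
      rw [mul_assoc]
      exact mul_le_mul_of_nonneg_left (JBStarAlgebra.norm_jmul_le x y) (norm_nonneg φ))

/-- The sum `M + M_*` for the couple `(M, M_*)`, where `F = M_*` is the predual; both spaces are
embedded in the dual of `M`, the algebra `M` by `x ↦ φ_x` and `F` by inclusion. -/
abbrev LSum (F : Submodule ℂ (StrongDual ℂ M)) (φ : StrongDual ℂ M) : Type _ :=
  Interp.Sum (jtranslate φ) (Pre.toDual F)

/-- The image in `M + M_*` of an element of `M`. -/
def ofAlg (F : Submodule ℂ (StrongDual ℂ M)) (φ : StrongDual ℂ M) (x : M) : LSum F φ :=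
  Interp.inl (jtranslate φ) (Pre.toDual F) x

open Classical in
/-- The nonassociative space `L^p(M, φ)`: the predual `F = M_*` if `p = 1` and the
interpolation space `(M, M_*)_{1/p}` if `1 < p < ∞`. -/
def LpSub (F : Submodule ℂ (StrongDual ℂ M)) (φ : StrongDual ℂ M) (p : ℝ) (hp : 1 ≤ p) :
    NormedSub (LSum F φ) :=
  if p = 1 then Interp.right (jtranslate φ) (Pre.toDual F) (Pre.toDual_injective F)
  else Interp.interp (jtranslate φ) (Pre.toDual F)
    ⟨1 / p, by positivity, by rw [one_div]; exact inv_le_one_of_one_le₀ hp⟩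

/-- `L^p(M, φ)` as a normed space. -/
abbrev JLp (F : Submodule ℂ (StrongDual ℂ M)) (φ : StrongDual ℂ M) (p : ℝ) (hp : 1 ≤ p) :
    Type _ := (LpSub F φ p hp).Elem

/-- A map `S` on `L^p(M, φ)` is induced by the map `T` on `M` if `M` is contained in
`L^p(M, φ)` and `S` extends `T`. -/
def Induces (F : Submodule ℂ (StrongDual ℂ M)) (φ : StrongDual ℂ M) (p : ℝ) (hp : 1 ≤ p)
    (T : M → M) (S : JLp F φ p hp → JLp F φ p hp) : Prop :=
  ∀ x : M, ∃ h : JLp F φ p hp, h.val = ofAlg F φ x ∧ (S h).val = ofAlg F φ (T x)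

/-- A JBW*-subalgebra: a weak* closed Jordan *-subalgebra. -/
structure JBWStarSubalgebra (F : Submodule ℂ (StrongDual ℂ M)) extends
    NonUnitalStarSubalgebra ℂ M where
  weakStarClosed : IsClosed[weakStar F] carrier

namespace JBWStarSubalgebra

variable {F : Submodule ℂ (StrongDual ℂ M)}

theorem isClosed (N : JBWStarSubalgebra F) :
    IsClosed (N.toNonUnitalStarSubalgebra : Set M) := by
  have hc : Continuous (fun (x : M) (ψ : F) => (ψ : StrongDual ℂ M) x) :=
    continuous_pi fun ψ => (ψ : StrongDual ℂ M).continuous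
  exact N.weakStarClosed.mono (continuous_iff_le_induced.1 hc)

/-- The underlying subspace. -/
abbrev toSub (N : JBWStarSubalgebra F) : Submodule ℂ M :=
  N.toNonUnitalStarSubalgebra.toNonUnitalSubalgebra.toSubmodule

/-- The JB*-algebra underlying a JBW*-subalgebra, with the restricted operations and norm. -/
abbrev Elem (N : JBWStarSubalgebra F) : Type _ := N.toSub

instance (N : JBWStarSubalgebra F) : JBStarAlgebra N.Elem where
  mul x y := ⟨x * y, N.mul_mem' x.2 y.2⟩
  left_distrib x y z := Subtype.ext (mul_add (x : M) y z)
  right_distrib x y z := Subtype.ext (add_mul (x : M) y z)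
  zero_mul x := Subtype.ext (zero_mul (x : M))
  mul_zero x := Subtype.ext (mul_zero (x : M))
  mul_comm x y := Subtype.ext (mul_comm (x : M) y)
  star x := ⟨star (x : M), N.star_mem' x.2⟩
  star_involutive x := Subtype.ext (star_star (x : M))
  star_mul x y := Subtype.ext (star_mul (x : M) y)
  star_add x y := Subtype.ext (star_add (x : M) y)
  complete := (N.isClosed.completeSpace_coe : CompleteSpace N.toSub).complete
  norm_smul_le c x := norm_smul_le c (x : M)
  smul_assoc c x y := Subtype.ext (smul_mul_assoc c (x : M) y)
  smul_comm c x y := Subtype.ext (mul_smul_comm c (x : M) (y : M)).symm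
  star_smul c x := Subtype.ext (star_smul c (x : M))
  lmul_comm_rmul_rmul x y := Subtype.ext (IsCommJordan.lmul_comm_rmul_rmul (x : M) y)
  norm_jmul_le x y := JBStarAlgebra.norm_jmul_le (x : M) y
  norm_jstar x := JBStarAlgebra.norm_jstar (x : M)
  norm_triple x := JBStarAlgebra.norm_triple (x : M)

/-- The inclusion of a JBW*-subalgebra. -/
def incl (N : JBWStarSubalgebra F) : N.Elem →L[ℂ] M := N.toSub.subtypeL

/-- The predual of a JBW*-subalgebra `N` of `M`: the restrictions to `N` of the elements of the
predual of `M`, that is the functionals on `N` that are continuous for the weak* topology. Its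
norm is that of the dual of `N`. -/
def predual (N : JBWStarSubalgebra F) : Submodule ℂ (StrongDual ℂ N.Elem) :=
  F.map (ContinuousLinearMap.precomp ℂ N.incl).toLinearMap

end JBWStarSubalgebra

/-- A normal contractive projection of `M` onto the JBW*-subalgebra `N`. Normal means weak*
continuous, that is, composition with `E` maps the predual into itself. -/
structure IsNormalContractiveProj (F : Submodule ℂ (StrongDual ℂ M)) (E : M →L[ℂ] M)
    (N : JBWStarSubalgebra F) : Prop where
  idem : ∀ x, E (E x) = E x
  contractive : ∀ x, ‖E x‖ ≤ ‖x‖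
  normal : ∀ ψ ∈ F, ψ.comp E ∈ F
  range_eq : Set.range E = N.carrier

end JB

end

section JordanIdentities

variable {A : Type*} [NonUnitalNonAssocCommRing A] [Module ℂ A] [IsCommJordan A]

/-- The linearized Jordan identity. -/
theorem jordan_linearized (a b c d : A) :
    a * (b * c * d) + b * (c * a * d) + c * (a * b * d) =
      b * c * (a * d) + c * a * (b * d) + a * b * (c * d) := by
  have h := DFunLike.congr_fun (two_nsmul_lie_lmul_lmul_add_add_eq_zero a b c) d
  simp only [Ring.lie_def, two_nsmul] at h
  have h2 : (2 : ℂ) • ((a * (b * c * d) - b * c * (a * d)) + (b * (c * a * d) - c * a * (b * d)) +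
      (c * (a * b * d) - a * b * (c * d))) = 0 := by
    rw [two_smul]
    exact h
  have h3 := (smul_eq_zero.1 h2).resolve_left two_ne_zero
  rw [← sub_eq_zero, ← h3]
  abel

/-- A formula for the multiplication by `a ∘ (a ∘ b)`. -/
theorem jordan_mul_mul_mul (a b y : A) :
    a * (a * b) * y = a * (a * b * y) + a * (a * b * y) + b * (a * a * y) - b * (a * (a * y))
      - a * (a * (b * y)) := by
  have h1 := jordan_linearized a b a y
  have h2 := jordan_linearized y b a a
  simp only [mul_comm] at h1 h2 ⊢
  linear_combination (norm := module) (1 : ℂ) • h2 - (1 : ℂ) • h1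

/-- The multiplication operators of a Jordan algebra act on the triple product like derivations
up to a sign. -/
theorem mul_triple (a x y : A) :
    a * (x * y * x + y * x * x - x * x * y) =
      (a * x * y * x + y * x * (a * x) - a * x * x * y) +
      (x * y * (a * x) + y * (a * x) * x - x * (a * x) * y) -
      (x * (a * y) * x + a * y * x * x - x * x * (a * y)) := by
  have h1 := jordan_linearized a x y x
  have h2 := jordan_linearized a x x y
  simp only [mul_add, mul_sub, mul_comm] at h1 h2 ⊢
  linear_combination (norm := module) (2 : ℂ) • h1 - (1 : ℂ) • h2

/-- The powers `a, a ∘ a, a ∘ (a ∘ a), …` of an element of a Jordan algebra. -/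
def jpow (a : A) : ℕ → A
  | 0 => a
  | n + 1 => a * jpow a n

variable [SMulCommClass ℂ A A] [IsScalarTower ℂ A A]

theorem commute_jpow (a : A) (n : ℕ) :
    Commute (LinearMap.mul ℂ A (jpow a n)) (LinearMap.mul ℂ A a) ∧
      Commute (LinearMap.mul ℂ A (jpow a n)) (LinearMap.mul ℂ A (a * a)) := by
  have h0 : Commute (LinearMap.mul ℂ A a) (LinearMap.mul ℂ A (a * a)) :=
    LinearMap.ext fun y => (IsJordan.lmul_lmul_comm_lmul a y).symm
  induction n using Nat.twoStepInduction with
  | zero => exact ⟨Commute.refl _, h0⟩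
  | one => exact ⟨h0.symm, Commute.refl _⟩
  | more n ih ih' =>
    have key : LinearMap.mul ℂ A (jpow a (n + 2)) =
        LinearMap.mul ℂ A a * LinearMap.mul ℂ A (jpow a (n + 1)) +
        LinearMap.mul ℂ A a * LinearMap.mul ℂ A (jpow a (n + 1)) +
        LinearMap.mul ℂ A (jpow a n) * LinearMap.mul ℂ A (a * a) -
        LinearMap.mul ℂ A (jpow a n) * (LinearMap.mul ℂ A a * LinearMap.mul ℂ A a) -
        LinearMap.mul ℂ A a * (LinearMap.mul ℂ A a * LinearMap.mul ℂ A (jpow a n)) :=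
      LinearMap.ext fun y => jordan_mul_mul_mul a (jpow a n) y
    have aux : ∀ T : Module.End ℂ A, Commute T (LinearMap.mul ℂ A a) →
        Commute T (LinearMap.mul ℂ A (a * a)) → Commute T (LinearMap.mul ℂ A (jpow a n)) →
        Commute T (LinearMap.mul ℂ A (jpow a (n + 1))) →
        Commute T (LinearMap.mul ℂ A (jpow a (n + 2))) := by
      intro T h1 h2 h3 h4
      rw [key]
      exact ((((h1.mul_right h4).add_right (h1.mul_right h4)).add_right
        (h3.mul_right h2)).sub_right (h3.mul_right (h1.mul_right h1))).sub_right
        (h1.mul_right (h1.mul_right h3))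
    exact ⟨(aux _ (Commute.refl _) h0 ih.1.symm ih'.1.symm).symm,
      (aux _ h0.symm (Commute.refl _) ih.2.symm ih'.2.symm).symm⟩

theorem jpow_mul_jpow (a : A) (m n : ℕ) : jpow a m * jpow a n = jpow a (m + n + 1) := by
  induction m with
  | zero => simp [jpow]
  | succ m ih =>
    have h := LinearMap.congr_fun (commute_jpow a n).1.eq (jpow a m)
    simp only [Module.End.mul_apply, LinearMap.mul_apply'] at h
    rw [show jpow a (m + 1) = a * jpow a m from rfl, mul_comm, h, mul_comm (jpow a n), ih,
      show m + 1 + n + 1 = (m + n + 1) + 1 by ring]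
    rfl

end JordanIdentities

section CStar

variable {A : Type*} [JBStarAlgebra A]

theorem star_jmul (x y : A) : star (x * y) = star x * star y := by rw [star_mul, mul_comm]

theorem IsSelfAdjoint.jmul {x y : A} (hx : IsSelfAdjoint x) (hy : IsSelfAdjoint y) :
    IsSelfAdjoint (x * y) := by
  rw [IsSelfAdjoint, star_jmul, hx.star_eq, hy.star_eq]

theorem continuous_jmul : Continuous fun p : A × A => p.1 * p.2 :=
  (LinearMap.mkContinuous₂ (LinearMap.mul ℂ A) 1 fun x y => by
    simpa using JBStarAlgebra.norm_jmul_le x y).continuous₂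

theorem continuous_jstar : Continuous (star : A → A) :=
  (AddMonoidHomClass.isometry_of_norm (starAddEquiv : A ≃+ A) JBStarAlgebra.norm_jstar).continuous

/-- A closed associative Jordan *-subalgebra. -/
structure ClosedAssocSub (A : Type*) [JBStarAlgebra A] extends Submodule ℂ A where
  mul_mem : ∀ {x y}, x ∈ carrier → y ∈ carrier → x * y ∈ carrier
  star_mem : ∀ {x}, x ∈ carrier → star x ∈ carrier
  assoc : ∀ {x y z}, x ∈ carrier → y ∈ carrier → z ∈ carrier → x * y * z = x * (y * z)
  isClosed : IsClosed carrier

namespace ClosedAssocSub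

/-- The C⋆-algebra underlying a closed associative subalgebra. -/
abbrev Elem (S : ClosedAssocSub A) : Type _ := S.toSubmodule

noncomputable instance (S : ClosedAssocSub A) : NonUnitalCommCStarAlgebra S.Elem where
  mul x y := ⟨x * y, S.mul_mem x.2 y.2⟩
  left_distrib x y z := Subtype.ext (mul_add (x : A) y z)
  right_distrib x y z := Subtype.ext (add_mul (x : A) y z)
  zero_mul x := Subtype.ext (zero_mul (x : A))
  mul_zero x := Subtype.ext (mul_zero (x : A))
  mul_assoc x y z := Subtype.ext (S.assoc x.2 y.2 z.2)
  mul_comm x y := Subtype.ext (mul_comm (x : A) y)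
  star x := ⟨star (x : A), S.star_mem x.2⟩
  star_involutive x := Subtype.ext (star_star (x : A))
  star_mul x y := Subtype.ext (star_mul (x : A) y)
  star_add x y := Subtype.ext (star_add (x : A) y)
  complete := (S.isClosed.completeSpace_coe : CompleteSpace S.toSubmodule).complete
  norm_mul_le x y := JBStarAlgebra.norm_jmul_le (x : A) y
  dist_eq x y := by
    rw [dist_comm, dist_eq_norm, sub_eq_neg_add]
  norm_mul_self_le x := by
    change ‖(x : A)‖ * ‖(x : A)‖ ≤ ‖star (x : A) * (x : A)‖
    have h := JBStarAlgebra.norm_triple (x : A)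
    have hs := S.star_mem x.2
    have h1 : (x : A) * star (x : A) * x + star (x : A) * x * x - x * x * star (x : A) =
        star (x : A) * x * x := by
      rw [S.assoc x.2 x.2 hs, mul_comm (x : A) (x * star (x : A)), mul_comm (x : A) (star (x : A))]
      abel
    rw [h1] at h
    have h2 := JBStarAlgebra.norm_jmul_le (star (x : A) * x) (x : A)
    rw [h] at h2
    rcases eq_or_lt_of_le (norm_nonneg (x : A)) with h0 | h0
    · rw [← h0]; simp
    · nlinarith
  __ := (inferInstance : NormedSpace ℂ S.toSubmodule)
  smul_assoc c x y := Subtype.ext (smul_mul_assoc c (x : A) y)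
  smul_comm c x y := Subtype.ext (mul_smul_comm c (x : A) (y : A)).symm
  star_smul c x := Subtype.ext (star_smul c (x : A))

@[simp]
theorem coe_mul (S : ClosedAssocSub A) (x y : S.Elem) : ((x * y : S.Elem) : A) = x * y := rfl

theorem isSelfAdjoint_iff (S : ClosedAssocSub A) (x : S.Elem) :
    IsSelfAdjoint x ↔ IsSelfAdjoint (x : A) := Subtype.ext_iff

/-- The closed subalgebra generated by a multiplicatively closed associative set of selfadjoint
elements. -/
def closedSpan (G : Set A) (hmul : ∀ x ∈ G, ∀ y ∈ G, x * y ∈ G)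
    (hstar : ∀ x ∈ G, IsSelfAdjoint x)
    (hassoc : ∀ x ∈ G, ∀ y ∈ G, ∀ z ∈ G, x * y * z = x * (y * z)) : ClosedAssocSub A where
  toSubmodule := (Submodule.span ℂ G).topologicalClosure
  mul_mem := by
    intro x y hx hy
    refine map_mem_closure₂ continuous_jmul hx hy fun a ha b hb => ?_
    refine Submodule.span_induction₂ (p := fun a b _ _ => a * b ∈ Submodule.span ℂ G)
      (fun a b ha hb => Submodule.subset_span (hmul a ha b hb)) (by simp) (by simp)
      (fun a b c _ _ _ h h' => ?_) (fun a b c _ _ _ h h' => ?_) (fun c a b _ _ h => ?_)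
      (fun c a b _ _ h => ?_) ha hb
    · rw [add_mul]; exact add_mem h h'
    · rw [mul_add]; exact add_mem h h'
    · rw [smul_mul_assoc]; exact Submodule.smul_mem _ _ h
    · rw [mul_smul_comm]; exact Submodule.smul_mem _ _ h
  star_mem := by
    intro x hx
    refine map_mem_closure continuous_jstar hx fun a ha => ?_
    refine Submodule.span_induction (p := fun a _ => star a ∈ Submodule.span ℂ G)
      (fun a ha => ?_) (by simp) (fun a b _ _ h h' => ?_) (fun c a _ h => ?_) ha
    · rw [(hstar a ha).star_eq]; exact Submodule.subset_span ha
    · rw [star_add]; exact add_mem h h'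
    · rw [star_smul]; exact Submodule.smul_mem _ _ h
  assoc := by
    have h1 : ∀ z ∈ G, ∀ y ∈ G, ∀ x ∈ closure (Submodule.span ℂ G : Set A),
        x * y * z = x * (y * z) := by
      intro z hz y hy x hx
      let W : Submodule ℂ A := LinearMap.eqLocus
        ((LinearMap.mul ℂ A).flip z ∘ₗ (LinearMap.mul ℂ A).flip y) ((LinearMap.mul ℂ A).flip (y * z))
      have hW : IsClosed (W : Set A) := isClosed_eq
        (continuous_jmul.comp ((continuous_jmul.comp (.prodMk_left y)).prodMk continuous_const))
        (continuous_jmul.comp (.prodMk_left (y * z)))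
      exact closure_minimal (Submodule.span_le.2 fun x hx => hassoc x hx y hy z hz) hW hx
    have h2 : ∀ z ∈ G, ∀ x ∈ closure (Submodule.span ℂ G : Set A),
        ∀ y ∈ closure (Submodule.span ℂ G : Set A), x * y * z = x * (y * z) := by
      intro z hz x hx y hy
      let W : Submodule ℂ A := LinearMap.eqLocus
        ((LinearMap.mul ℂ A).flip z ∘ₗ (LinearMap.mul ℂ A x))
        ((LinearMap.mul ℂ A x) ∘ₗ ((LinearMap.mul ℂ A).flip z))
      have hW : IsClosed (W : Set A) := isClosed_eq
        (continuous_jmul.comp ((continuous_jmul.comp (.prodMk_right x)).prodMk continuous_const))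
        (continuous_jmul.comp (continuous_const.prodMk (continuous_jmul.comp (.prodMk_left z))))
      exact closure_minimal (Submodule.span_le.2 fun y hy => h1 z hz y hy x hx) hW hy
    intro x y z hx hy hz
    let W : Submodule ℂ A := LinearMap.eqLocus (LinearMap.mul ℂ A (x * y))
        ((LinearMap.mul ℂ A x) ∘ₗ (LinearMap.mul ℂ A y))
    have hW : IsClosed (W : Set A) := isClosed_eq
      (continuous_jmul.comp (.prodMk_right (x * y)))
      (continuous_jmul.comp (continuous_const.prodMk (continuous_jmul.comp (.prodMk_right y))))
    exact closure_minimal (Submodule.span_le.2 fun z hz => h2 z hz x hx y hy) hW hz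
  isClosed := (Submodule.span ℂ G).isClosed_topologicalClosure

theorem mem_closedSpan {G : Set A} {hmul hstar hassoc} {x : A} (hx : x ∈ G) :
    x ∈ (closedSpan G hmul hstar hassoc).toSubmodule :=
  subset_closure (Submodule.subset_span hx)

end ClosedAssocSub

theorem IsSelfAdjoint.jpow {a : A} (ha : IsSelfAdjoint a) (n : ℕ) : IsSelfAdjoint (jpow a n) := by
  induction n with
  | zero => exact ha
  | succ n ih => exact ha.jmul ih

/-- A selfadjoint element is contained in a commutative C⋆-subalgebra. -/
theorem exists_closedAssocSub {a : A} (ha : IsSelfAdjoint a) :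
    ∃ S : ClosedAssocSub A, a ∈ S.toSubmodule := by
  refine ⟨ClosedAssocSub.closedSpan (Set.range (jpow a)) ?_ ?_ ?_,
    ClosedAssocSub.mem_closedSpan ⟨0, rfl⟩⟩
  · rintro _ ⟨m, rfl⟩ _ ⟨n, rfl⟩
    exact ⟨_, (jpow_mul_jpow a m n).symm⟩
  · rintro _ ⟨m, rfl⟩
    exact ha.jpow m
  · rintro _ ⟨m, rfl⟩ _ ⟨n, rfl⟩ _ ⟨k, rfl⟩
    simp only [jpow_mul_jpow]
    congr 1
    ring

/-- A selfadjoint element of a unital JB*-algebra is contained in a commutative C⋆-subalgebra that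
contains the unit. -/
theorem exists_unital_closedAssocSub {e a : A} (he : ∀ x, e * x = x) (hse : IsSelfAdjoint e)
    (ha : IsSelfAdjoint a) :
    ∃ S : ClosedAssocSub A, e ∈ S.toSubmodule ∧ a ∈ S.toSubmodule := by
  have he' : ∀ x, x * e = x := fun x => by rw [mul_comm, he]
  refine ⟨ClosedAssocSub.closedSpan (insert e (Set.range (jpow a))) ?_ ?_ ?_,
    ClosedAssocSub.mem_closedSpan (Set.mem_insert _ _),
    ClosedAssocSub.mem_closedSpan (Set.mem_insert_of_mem _ ⟨0, rfl⟩)⟩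
  · rintro _ (rfl | ⟨m, rfl⟩) _ (rfl | ⟨n, rfl⟩)
    · simp [he]
    · simp [he]
    · simp [he']
    · exact .inr ⟨_, (jpow_mul_jpow a m n).symm⟩
  · rintro _ (rfl | ⟨m, rfl⟩)
    · exact hse
    · exact ha.jpow m
  · rintro _ (rfl | ⟨m, rfl⟩) _ (rfl | ⟨n, rfl⟩) _ (rfl | ⟨k, rfl⟩)
    all_goals simp only [he, he', jpow_mul_jpow]
    congr 1
    ring

/-- A closed associative subalgebra containing the unit is a unital normed ring. -/
noncomputable abbrev ClosedAssocSub.normedCommRing (S : ClosedAssocSub A) {e : A}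
    (he : ∀ x, e * x = x) (hS : e ∈ S.toSubmodule) : NormedCommRing S.Elem where
  __ := (inferInstance : NonUnitalNormedCommRing S.Elem)
  one := ⟨e, hS⟩
  one_mul x := Subtype.ext (he x)
  mul_one x := Subtype.ext ((mul_comm _ _).trans (he x))

/-- A closed associative subalgebra containing the unit is a unital C⋆-algebra. -/
noncomputable abbrev ClosedAssocSub.commCStarAlgebra (S : ClosedAssocSub A) {e : A}
    (he : ∀ x, e * x = x) (hS : e ∈ S.toSubmodule) : CommCStarAlgebra S.Elem :=
  letI := S.normedCommRing he hS
  { S.normedCommRing he hS, (inferInstance : NonUnitalCommCStarAlgebra S.Elem),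
    Algebra.ofModule (R := ℂ) (A := S.Elem) (smul_mul_assoc (β := S.Elem))
      (mul_smul_comm (β := S.Elem)) with
    norm_smul_le := norm_smul_le }

end CStar

section CStarOrder

variable {C : Type*} [CommCStarAlgebra C]
attribute [local instance] CStarAlgebra.spectralOrder CStarAlgebra.spectralOrderedRing

theorem cstar_nonneg_of_norm_sub_le {x : C} (hx : IsSelfAdjoint x) {r : ℝ}
    (h : ‖algebraMap ℝ C r - x‖ ≤ r) : 0 ≤ x := by
  have h1 : IsSelfAdjoint (algebraMap ℝ C r - x) := (IsSelfAdjoint.algebraMap C (.all r)).sub hx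
  have h2 := h1.le_algebraMap_norm_self
  have h3 : algebraMap ℝ C ‖algebraMap ℝ C r - x‖ ≤ algebraMap ℝ C r := algebraMap_mono C h
  simpa using h2.trans h3

theorem cstar_norm_sub_le {x : C} (hx : 0 ≤ x) {r : ℝ} (h : ‖x‖ ≤ r) :
    ‖algebraMap ℝ C r - x‖ ≤ r := by
  have h1 := (IsSelfAdjoint.of_nonneg hx).le_algebraMap_norm_self
  have h3 : algebraMap ℝ C ‖x‖ ≤ algebraMap ℝ C r := algebraMap_mono C h
  refine (CStarAlgebra.norm_le_iff_le_algebraMap _ ((norm_nonneg _).trans h)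
    (sub_nonneg.2 (h1.trans h3))).2 ?_
  simpa using hx

theorem cstar_exists_sq {x : C} (hx : 0 ≤ x) : ∃ s : C, IsSelfAdjoint s ∧ s * s = x :=
  ⟨CFC.sqrt x, (CFC.sqrt_nonneg x).isSelfAdjoint, CFC.sqrt_mul_sqrt_self x⟩

theorem cstar_norm_le {x : C} (hx : IsSelfAdjoint x) {r : ℝ} (hr : 0 ≤ r)
    (h1 : 0 ≤ algebraMap ℝ C r - x) (h2 : 0 ≤ algebraMap ℝ C r + x) : ‖x‖ ≤ r := by
  have h3 : 0 ≤ (algebraMap ℝ C r - x) * (algebraMap ℝ C r + x) := by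
    exact Commute.mul_nonneg h1 h2 (Commute.all _ _)
  have h4 : x * x ≤ algebraMap ℝ C (r * r) := by
    rw [← sub_nonneg, map_mul]
    convert h3 using 1; ring
  have h5 : 0 ≤ x * x := by simpa [hx.star_eq] using star_mul_self_nonneg x
  have h6 := (CStarAlgebra.norm_le_iff_le_algebraMap _ (by positivity) h5).2 h4
  have h7 : ‖x * x‖ = ‖x‖ * ‖x‖ := by
    have := CStarRing.norm_star_mul_self (x := x)
    rwa [hx.star_eq] at this
  rw [h7] at h6
  exact abs_le_of_sq_le_sq' (by nlinarith) hr |>.2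

theorem cstar_sub_sq_nonneg {x : C} (hx : 0 ≤ x) :
    0 ≤ ‖x‖ • x - x * x := by
  have h1 := (IsSelfAdjoint.of_nonneg hx).le_algebraMap_norm_self
  have h3 := Commute.mul_nonneg (sub_nonneg.2 h1) hx (Commute.all _ _)
  convert h3 using 1
  rw [sub_mul, Algebra.smul_def]

end CStarOrder

section Order

variable {A : Type*} [JBStarAlgebra A] {e : A}

theorem junit_isSelfAdjoint (he : ∀ x, e * x = x) : IsSelfAdjoint e := by
  have h : star e * e = e := by
    have h1 : star e * e = star (e * star e) := by rw [star_jmul, star_star]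
    rw [h1, he, star_star]
  rw [IsSelfAdjoint, ← he (star e), mul_comm, h]

theorem norm_junit_le (he : ∀ x, e * x = x) : ‖e‖ ≤ 1 := by
  have h := JBStarAlgebra.norm_triple e
  rw [(junit_isSelfAdjoint he).star_eq, he, he, add_sub_cancel_right] at h
  by_contra! h1
  have h2 := pow_lt_pow_right₀ h1 (show 1 < 3 by norm_num)
  linarith [pow_one ‖e‖]

theorem isSelfAdjoint_ofReal_smul {a : A} (ha : IsSelfAdjoint a) (r : ℝ) :
    IsSelfAdjoint ((r : ℂ) • a) := by
  rw [IsSelfAdjoint, star_smul, ha.star_eq]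
  simp

/-- Positive elements: the squares of selfadjoint elements. -/
def JPos (a : A) : Prop := ∃ s : A, IsSelfAdjoint s ∧ s * s = a

theorem JPos.isSelfAdjoint {a : A} (h : JPos a) : IsSelfAdjoint a := by
  obtain ⟨s, hs, rfl⟩ := h
  exact hs.jmul hs

section Transfer

attribute [local instance] CStarAlgebra.spectralOrder CStarAlgebra.spectralOrderedRing

theorem jpos_of_norm_sub_le (he : ∀ x, e * x = x) {a : A} (ha : IsSelfAdjoint a) {r : ℝ}
    (h : ‖(r : ℂ) • e - a‖ ≤ r) : JPos a := by
  obtain ⟨S, hS, haS⟩ := exists_unital_closedAssocSub he (junit_isSelfAdjoint he) ha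
  let _ := S.commCStarAlgebra he hS
  have hx : IsSelfAdjoint (⟨a, haS⟩ : S.Elem) := Subtype.ext ha
  obtain ⟨s, hs, hsx⟩ := cstar_exists_sq (cstar_nonneg_of_norm_sub_le hx (r := r) h)
  exact ⟨s, congrArg Subtype.val hs, congrArg Subtype.val hsx⟩

theorem JPos.norm_sub_le (he : ∀ x, e * x = x) {a : A} (ha : JPos a) {r : ℝ} (h : ‖a‖ ≤ r) :
    ‖(r : ℂ) • e - a‖ ≤ r := by
  obtain ⟨s, hs, rfl⟩ := ha
  obtain ⟨S, hS, haS⟩ := exists_unital_closedAssocSub he (junit_isSelfAdjoint he) hs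
  let _ := S.commCStarAlgebra he hS
  have hx : IsSelfAdjoint (⟨s, haS⟩ : S.Elem) := Subtype.ext hs
  have h5 : 0 ≤ (⟨s, haS⟩ : S.Elem) * ⟨s, haS⟩ := by
    simpa [hx.star_eq] using star_mul_self_nonneg (⟨s, haS⟩ : S.Elem)
  exact cstar_norm_sub_le h5 h

theorem norm_le_of_jpos (he : ∀ x, e * x = x) {a : A} (ha : IsSelfAdjoint a) {r : ℝ} (hr : 0 ≤ r)
    (h1 : JPos ((r : ℂ) • e - a)) (h2 : JPos ((r : ℂ) • e + a)) : ‖a‖ ≤ r := by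
  obtain ⟨S, hS, haS⟩ := exists_unital_closedAssocSub he (junit_isSelfAdjoint he) ha
  let _ := S.commCStarAlgebra he hS
  have hx : IsSelfAdjoint (⟨a, haS⟩ : S.Elem) := Subtype.ext ha
  have hr' : IsSelfAdjoint (algebraMap ℝ S.Elem r) := IsSelfAdjoint.algebraMap _ (.all r)
  exact cstar_norm_le hx hr (cstar_nonneg_of_norm_sub_le (hr'.sub hx) (h1.norm_sub_le he le_rfl))
    (cstar_nonneg_of_norm_sub_le (hr'.add hx) (h2.norm_sub_le he le_rfl))

theorem JPos.norm_smul_sub_sq (he : ∀ x, e * x = x) {a : A} (ha : JPos a) :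
    JPos ((‖a‖ : ℂ) • a - a * a) := by
  obtain ⟨S, hS, haS⟩ := exists_unital_closedAssocSub he (junit_isSelfAdjoint he) ha.isSelfAdjoint
  let _ := S.commCStarAlgebra he hS
  have hx : IsSelfAdjoint (⟨a, haS⟩ : S.Elem) := Subtype.ext ha.isSelfAdjoint
  obtain ⟨s, hs, hsx⟩ := cstar_exists_sq (cstar_sub_sq_nonneg
    (cstar_nonneg_of_norm_sub_le hx (ha.norm_sub_le he le_rfl)))
  exact ⟨s, congrArg Subtype.val hs, congrArg Subtype.val hsx⟩

theorem norm_add_I_smul_le (he : ∀ x, e * x = x) {a : A} (ha : IsSelfAdjoint a) (r : ℝ) :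
    ‖a + (r * Complex.I) • e‖ ^ 2 ≤ ‖a‖ ^ 2 + r ^ 2 := by
  have hse := junit_isSelfAdjoint he
  obtain ⟨S, hS, haS⟩ := exists_unital_closedAssocSub he hse ha
  let x : S.Elem := ⟨a + (r * Complex.I) • e, add_mem haS (Submodule.smul_mem _ _ hS)⟩
  have h := CStarRing.norm_star_mul_self (x := x)
  have h2 : ((star x * x : S.Elem) : A) = a * a + ((r ^ 2 : ℝ) : ℂ) • e := by
    have h3 : star (a + (r * Complex.I) • e) = a - (r * Complex.I) • e := by
      rw [star_add, star_smul, ha.star_eq, hse.star_eq]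
      simp [sub_eq_add_neg]
    change star (a + (r * Complex.I) • e) * (a + (r * Complex.I) • e) = _
    rw [h3, sub_mul, mul_add, mul_add, mul_smul_comm, smul_mul_assoc, smul_mul_assoc, mul_comm a e,
      he, mul_smul_comm, he, smul_smul]
    have : (r * Complex.I) * (r * Complex.I) = -((r ^ 2 : ℝ) : ℂ) := by
      push_cast
      linear_combination (r : ℂ) ^ 2 * Complex.I_sq
    rw [this]
    module
  have h4 : ‖star x * x‖ ≤ ‖a‖ * ‖a‖ + r ^ 2 := by
    change ‖((star x * x : S.Elem) : A)‖ ≤ _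
    rw [h2]
    refine (norm_add_le _ _).trans (add_le_add (JBStarAlgebra.norm_jmul_le a a) ?_)
    rw [norm_smul, Complex.norm_real, Real.norm_of_nonneg (by positivity)]
    exact mul_le_of_le_one_right (by positivity) (norm_junit_le he)
  rw [h] at h4
  change ‖x‖ ^ 2 ≤ _
  nlinarith

end Transfer

theorem jpos_sub_of_norm_le (he : ∀ x, e * x = x) {a : A} (ha : IsSelfAdjoint a) {r : ℝ}
    (h : ‖a‖ ≤ r) : JPos ((r : ℂ) • e - a) :=
  jpos_of_norm_sub_le he ((isSelfAdjoint_ofReal_smul (junit_isSelfAdjoint he) r).sub ha) (r := r)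
    (by simpa using h)

theorem jpos_add_of_norm_le (he : ∀ x, e * x = x) {a : A} (ha : IsSelfAdjoint a) {r : ℝ}
    (h : ‖a‖ ≤ r) : JPos ((r : ℂ) • e + a) := by
  simpa using jpos_sub_of_norm_le he ha.neg (r := r) (by simpa using h)

theorem JPos.add (he : ∀ x, e * x = x) {a b : A} (ha : JPos a) (hb : JPos b) : JPos (a + b) := by
  refine jpos_of_norm_sub_le he (ha.isSelfAdjoint.add hb.isSelfAdjoint) (r := ‖a‖ + ‖b‖) ?_
  have h : ((‖a‖ + ‖b‖ : ℝ) : ℂ) • e - (a + b) =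
      ((‖a‖ : ℂ) • e - a) + ((‖b‖ : ℂ) • e - b) := by
    push_cast; module
  rw [h]
  exact (norm_add_le _ _).trans
    (add_le_add (ha.norm_sub_le he le_rfl) (hb.norm_sub_le he le_rfl))

theorem JPos.smul {a : A} (ha : JPos a) {r : ℝ} (hr : 0 ≤ r) : JPos ((r : ℂ) • a) := by
  obtain ⟨s, hs, rfl⟩ := ha
  refine ⟨((√r : ℝ) : ℂ) • s, isSelfAdjoint_ofReal_smul hs _, ?_⟩
  rw [smul_mul_smul_comm, ← Complex.ofReal_mul, Real.mul_self_sqrt hr]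

theorem jpos_junit (he : ∀ x, e * x = x) : JPos e := ⟨e, junit_isSelfAdjoint he, he e⟩

theorem jpos_zero : JPos (0 : A) := ⟨0, .zero _, mul_zero _⟩

theorem isClosed_jpos (he : ∀ x, e * x = x) : IsClosed {a : A | JPos a} := by
  have h : {a : A | JPos a} = {a | star a = a} ∩ {a | ‖(‖a‖ : ℂ) • e - a‖ ≤ ‖a‖} := by
    ext a
    exact ⟨fun h => ⟨h.isSelfAdjoint, h.norm_sub_le he le_rfl⟩,
      fun h => jpos_of_norm_sub_le he h.1 h.2⟩
  rw [h]
  refine (isClosed_eq continuous_jstar continuous_id).inter (isClosed_le ?_ continuous_norm)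
  fun_prop

/-- Decomposition of an element in its real and imaginary parts. -/
theorem exists_re_im (x : A) : ∃ u v : A, IsSelfAdjoint u ∧ IsSelfAdjoint v ∧
    x = u + Complex.I • v ∧ ‖u‖ ≤ ‖x‖ ∧ ‖v‖ ≤ ‖x‖ ∧ u = (1 / 2 : ℂ) • (x + star x) := by
  have h : ∀ y : A, ‖y‖ ≤ ‖x‖ → ∀ c : ℂ, ‖c‖ = 1 / 2 → ‖c • (x + y)‖ ≤ ‖x‖ := by
    intro y hy c hc
    rw [norm_smul, hc]
    linarith [norm_add_le x y]
  refine ⟨(1 / 2 : ℂ) • (x + star x), (-Complex.I / 2) • (x + -star x), ?_, ?_, ?_, ?_, ?_, rfl⟩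
  · simp [IsSelfAdjoint, star_smul, add_comm]
  · simp only [IsSelfAdjoint, star_smul, star_add, star_neg, star_star, RCLike.star_def, map_div₀,
      map_neg, Complex.conj_I, map_ofNat]
    module
  · rw [smul_smul, show Complex.I * (-Complex.I / 2) = 1 / 2 by
      linear_combination (-1 / 2 : ℂ) * Complex.I_sq]
    module
  · exact h _ (JBStarAlgebra.norm_jstar x).le _ (by simp)
  · exact h _ (by rw [norm_neg]; exact (JBStarAlgebra.norm_jstar x).le) _ (by simp)

theorem norm_im_le {u v : A} (hu : IsSelfAdjoint u) (hv : IsSelfAdjoint v) :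
    ‖v‖ ≤ ‖u + Complex.I • v‖ := by
  have h1 : star (u + Complex.I • v) = u - Complex.I • v := by
    simp [star_smul, hu.star_eq, hv.star_eq, sub_eq_add_neg]
  have h2 : (2 * Complex.I) • v = (u + Complex.I • v) - star (u + Complex.I • v) := by
    rw [h1]; module
  have h3 : ‖(2 * Complex.I) • v‖ ≤ ‖u + Complex.I • v‖ + ‖u + Complex.I • v‖ := by
    rw [h2]
    exact (norm_sub_le _ _).trans (by rw [JBStarAlgebra.norm_jstar])
  rw [norm_smul] at h3
  simp at h3
  linarith

section Unital

variable {A' : Type*} [JBStarAlgebra A'] {e' : A'}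

/-- A unital contraction preserves selfadjoint elements. -/
theorem isSelfAdjoint_map_of_contractive (he : ∀ x, e * x = x) (he' : ∀ x, e' * x = x)
    (T : A →ₗ[ℂ] A') (hT : ∀ x, ‖T x‖ ≤ ‖x‖) (hTe : T e = e') {a : A} (ha : IsSelfAdjoint a) :
    IsSelfAdjoint (T a) := by
  obtain ⟨u, v, hu, hv, huv, -, -, -⟩ := exists_re_im (T a)
  have hse := junit_isSelfAdjoint he'
  have key : ∀ r : ℝ, ‖v + (r : ℂ) • e'‖ ^ 2 ≤ ‖a‖ ^ 2 + r ^ 2 := by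
    intro r
    refine le_trans ?_ (norm_add_I_smul_le he ha r)
    gcongr
    refine le_trans ?_ (hT _)
    have : T (a + (r * Complex.I) • e) = u + Complex.I • (v + (r : ℂ) • e') := by
      rw [map_add, map_smul, hTe, huv]; module
    rw [this]
    exact norm_im_le hu (hv.add (isSelfAdjoint_ofReal_smul hse r))
  have key2 : ∀ r : ℝ, 0 < r → ‖v‖ ≤ ‖a‖ ^ 2 / r := by
    intro r hr
    have h0 : (0 : ℝ) ≤ ‖a‖ ^ 2 + r ^ 2 := by positivity
    set R := √(‖a‖ ^ 2 + r ^ 2) with hR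
    have hR2 : R ^ 2 = ‖a‖ ^ 2 + r ^ 2 := Real.sq_sqrt h0
    have hR0 : 0 ≤ R := Real.sqrt_nonneg _
    have hRr : r ≤ R := Real.le_sqrt_of_sq_le (by nlinarith [sq_nonneg ‖a‖])
    have h1 : ‖v + (r : ℂ) • e'‖ ≤ R := Real.le_sqrt_of_sq_le (key r)
    have h2 : ‖v + ((-r : ℝ) : ℂ) • e'‖ ≤ R :=
      Real.le_sqrt_of_sq_le ((key (-r)).trans (by rw [neg_sq]))
    have h3 : ‖v‖ ≤ R - r := by
      refine norm_le_of_jpos he' hv (by linarith) ?_ ?_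
      · have := jpos_sub_of_norm_le he' (hv.add (isSelfAdjoint_ofReal_smul hse r)) h1
        convert this using 1
        push_cast; module
      · have := jpos_add_of_norm_le he' (hv.add (isSelfAdjoint_ofReal_smul hse (-r))) h2
        convert this using 1
        push_cast; module
    rw [le_div_iff₀ hr]
    nlinarith [norm_nonneg v]
  have hv0 : ‖v‖ ≤ 0 := by
    have : Filter.Tendsto (fun r : ℝ => ‖a‖ ^ 2 / r) Filter.atTop (𝓝 0) :=
      Filter.Tendsto.div_atTop tendsto_const_nhds Filter.tendsto_id
    exact ge_of_tendsto this ((Filter.eventually_gt_atTop 0).mono key2)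
  rw [huv, norm_le_zero_iff.1 hv0]
  simpa using hu

/-- A unital contraction is positive. -/
theorem JPos.map_of_contractive (he : ∀ x, e * x = x) (he' : ∀ x, e' * x = x)
    (T : A →ₗ[ℂ] A') (hT : ∀ x, ‖T x‖ ≤ ‖x‖) (hTe : T e = e') {a : A} (ha : JPos a) :
    JPos (T a) := by
  refine jpos_of_norm_sub_le he'
    (isSelfAdjoint_map_of_contractive he he' T hT hTe ha.isSelfAdjoint) (r := ‖a‖) ?_
  rw [← hTe, ← map_smul, ← map_sub]
  exact (hT _).trans (ha.norm_sub_le he le_rfl)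

end Unital

section State

variable {ρ : A →ₗ[ℂ] ℂ}

theorem state_im_eq_zero (he : ∀ x, e * x = x) (hρ : ∀ x, ‖ρ x‖ ≤ ‖x‖) (hρe : ρ e = 1)
    {a : A} (ha : IsSelfAdjoint a) : (ρ a).im = 0 := by
  have he0 : e ≠ 0 := by rintro rfl; simp at hρe
  have hse := junit_isSelfAdjoint he
  have h := isSelfAdjoint_map_of_contractive he he (ρ.smulRight e)
    (fun x => by
      rw [LinearMap.smulRight_apply, norm_smul]
      exact (mul_le_of_le_one_right (norm_nonneg _) (norm_junit_le he)).trans (hρ x))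
    (by simp [hρe]) ha
  rw [LinearMap.smulRight_apply, IsSelfAdjoint, star_smul, hse.star_eq] at h
  exact Complex.conj_eq_iff_im.1 (smul_left_injective ℂ he0 h)

theorem state_re_nonneg (he : ∀ x, e * x = x) (hρ : ∀ x, ‖ρ x‖ ≤ ‖x‖) (hρe : ρ e = 1)
    {a : A} (ha : JPos a) : 0 ≤ (ρ a).re := by
  have h := (hρ _).trans (ha.norm_sub_le he le_rfl)
  rw [map_sub, map_smul, hρe] at h
  have h2 := (Complex.abs_re_le_norm _).trans h
  simp at h2
  have := (abs_le.1 h2).2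
  linarith

/-- The Cauchy–Schwarz inequality in the degenerate case. -/
theorem state_mul_eq_zero (he : ∀ x, e * x = x) (hρ : ∀ x, ‖ρ x‖ ≤ ‖x‖) (hρe : ρ e = 1)
    {a y : A} (ha : IsSelfAdjoint a) (hy : IsSelfAdjoint y) (h : (ρ (y * y)).re = 0) :
    ρ (a * y) = 0 := by
  refine Complex.ext ?_ (state_im_eq_zero he hρ hρe (ha.jmul hy))
  have key : ∀ t : ℝ, 0 ≤ (ρ (a * a)).re + 2 * t * (ρ (a * y)).re := by
    intro t
    have h1 := ha.add (isSelfAdjoint_ofReal_smul hy t)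
    have h2 := state_re_nonneg he hρ hρe ⟨_, h1, rfl⟩
    rw [add_mul, mul_add, mul_add, mul_smul_comm, smul_mul_assoc, smul_mul_smul_comm, mul_comm y a]
      at h2
    simp only [map_add, map_smul, Complex.add_re, smul_eq_mul, Complex.re_ofReal_mul,
      ← Complex.ofReal_mul, h] at h2
    linarith
  simp only [Complex.zero_re]
  by_contra h0
  have := key (-((ρ (a * a)).re + 1) / (2 * (ρ (a * y)).re))
  rw [mul_div_assoc', mul_comm 2, mul_comm 2, mul_div_mul_right _ _ two_ne_zero,
    div_mul_cancel₀ _ h0] at this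
  linarith

theorem state_mul_eq_zero_of_jpos (he : ∀ x, e * x = x) (hρ : ∀ x, ‖ρ x‖ ≤ ‖x‖) (hρe : ρ e = 1)
    {a y : A} (ha : IsSelfAdjoint a) (hy : JPos y) (h : (ρ y).re = 0) : ρ (a * y) = 0 := by
  refine state_mul_eq_zero he hρ hρe ha hy.isSelfAdjoint (le_antisymm ?_ ?_)
  · have h1 := state_re_nonneg he hρ hρe (hy.norm_smul_sub_sq he)
    simp only [map_sub, map_smul, Complex.sub_re, smul_eq_mul, Complex.re_ofReal_mul, h] at h1
    linarith
  · exact state_re_nonneg he hρ hρe ⟨y, hy.isSelfAdjoint, rfl⟩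

end State

/-- The lower bound of the spectrum of a selfadjoint element is attained by a state. -/
theorem exists_state_eq_lower_bound (he : ∀ x, e * x = x) (he0 : e ≠ 0) {y : A}
    (hy : IsSelfAdjoint y) :
    ∃ (m : ℝ) (ρ : A →ₗ[ℂ] ℂ), (∀ x, ‖ρ x‖ ≤ ‖x‖) ∧ ρ e = 1 ∧ JPos (y - (m : ℂ) • e) ∧
      ρ y = m := by
  have hse := junit_isSelfAdjoint he
  set z : A := (‖y‖ : ℂ) • e - y with hz
  have hzp : JPos z := jpos_sub_of_norm_le he hy le_rfl
  have hn : 1 + ‖z‖ ≤ ‖e + z‖ := by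
    have h1 := jpos_sub_of_norm_le he (hse.add hzp.isSelfAdjoint) le_rfl
    have h1' : JPos (((‖e + z‖ - 1 : ℝ) : ℂ) • e - z) := by
      convert h1 using 1
      push_cast; module
    have h3 : JPos (((‖e + z‖ - 1 : ℝ) : ℂ) • e) := by
      have := h1'.add he hzp
      rwa [sub_add_cancel] at this
    have h4 : 0 ≤ ‖e + z‖ - 1 := by
      by_contra! hlt
      have h5 := h3.norm_sub_le he le_rfl
      rw [← sub_smul, norm_smul, norm_smul, ← Complex.ofReal_sub, Complex.norm_real,
        Complex.norm_real, Real.norm_of_nonpos hlt.le, Real.norm_of_nonneg] at h5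
      · have h6 := norm_pos_iff.2 he0
        nlinarith [mul_pos (mul_pos (neg_pos.2 hlt) h6) h6]
      · nlinarith [norm_pos_iff.2 he0]
    have := norm_le_of_jpos he hzp.isSelfAdjoint h4 h1' (h3.add he hzp)
    linarith
  obtain ⟨g, hg1, hg2⟩ := exists_dual_vector'' ℂ (e + z)
  have hg : ∀ x, ‖g x‖ ≤ ‖x‖ := fun x => (g.le_of_opNorm_le hg1 x).trans (by simp)
  have hgz := (Complex.re_le_norm _).trans (hg z)
  have hge := ((Complex.re_le_norm _).trans (hg e))
  have hge' := (hg e).trans (norm_junit_le he)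
  have hre : (g e).re + (g z).re = ‖e + z‖ := by
    rw [← Complex.add_re, ← map_add, hg2]; simp
  have hone : (g e).re = 1 := by linarith [norm_junit_le he]
  have hge1 : g e = 1 := by
    refine Complex.ext hone ?_
    have h1 := Complex.sq_norm_sub_sq_re (g e)
    rw [hone] at h1
    simp only [Complex.one_im]
    nlinarith [norm_nonneg (g e), sq_nonneg (g e).im]
  have hgz' : (g z).re = ‖z‖ := by linarith
  refine ⟨‖y‖ - ‖z‖, g.toLinearMap, hg, hge1, ?_, ?_⟩
  · convert jpos_sub_of_norm_le he hzp.isSelfAdjoint le_rfl using 1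
    rw [hz]; push_cast; module
  · have h1 : (g y).im = 0 := state_im_eq_zero (ρ := g.toLinearMap) he hg hge1 hy
    have h2 : g z = (‖y‖ : ℂ) - g y := by rw [hz, map_sub, map_smul, hge1]; simp
    refine Complex.ext ?_ (by simpa using h1)
    rw [h2] at hgz'
    simp at hgz' ⊢
    linarith

end Order

section Multiplication

variable {A : Type*} [JBStarAlgebra A]

/-- The operator of multiplication by an element. -/
noncomputable def jL : A →L[ℂ] A →L[ℂ] A :=
  LinearMap.mkContinuous₂ (LinearMap.mul ℂ A) 1 fun x y => by
    simpa using JBStarAlgebra.norm_jmul_le x y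

@[simp]
theorem jL_apply (a x : A) : jL a x = a * x := rfl

theorem norm_jL_le (a : A) : ‖jL a‖ ≤ ‖a‖ :=
  ContinuousLinearMap.opNorm_le_bound _ (norm_nonneg a) fun x => JBStarAlgebra.norm_jmul_le a x

theorem HasDerivAt.jmul {X Y : ℂ → A} {X' Y' : A} {z : ℂ} (hX : HasDerivAt X X' z)
    (hY : HasDerivAt Y Y' z) : HasDerivAt (fun z => X z * Y z) (X' * Y z + X z * Y') z := by
  have h1 : HasDerivAt (fun z => jL (X z)) (jL X') z :=
    (jL : A →L[ℂ] A →L[ℂ] A).hasFDerivAt.comp_hasDerivAt z hX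
  have h2 := h1.clm_apply hY
  simp only [jL_apply] at h2
  exact h2

theorem clm_exp_add_of_commute {T T' : A →L[ℂ] A} (h : Commute T T') :
    NormedSpace.exp (T + T') = NormedSpace.exp T * NormedSpace.exp T' := by
  let _ : NormedAlgebra ℚ (A →L[ℂ] A) := NormedAlgebra.restrictScalars ℚ ℂ _
  exact NormedSpace.exp_add_of_commute h

theorem clm_exp_continuous : Continuous (NormedSpace.exp : (A →L[ℂ] A) → A →L[ℂ] A) := by
  let _ : NormedAlgebra ℚ (A →L[ℂ] A) := NormedAlgebra.restrictScalars ℚ ℂ _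
  exact NormedSpace.exp_continuous

theorem hasDerivAt_exp_smul_apply (T : A →L[ℂ] A) (x : A) (z : ℂ) :
    HasDerivAt (fun z : ℂ => NormedSpace.exp (z • T) x) (T (NormedSpace.exp (z • T) x)) z := by
  have h := (hasDerivAt_exp_smul_const' (𝕂 := ℂ) T z).clm_apply (hasDerivAt_const z x)
  simpa using h

theorem hasSum_exp_apply (T : A →L[ℂ] A) (x : A) :
    HasSum (fun n : ℕ => ((n.factorial : ℂ)⁻¹) • (T ^ n) x) (NormedSpace.exp T x) := by
  have h := NormedSpace.exp_series_hasSum_exp' (𝕂 := ℂ) T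
  exact h.mapL (ContinuousLinearMap.apply ℂ A x)

theorem exp_neg_mul_exp_apply (T : A →L[ℂ] A) (x : A) :
    NormedSpace.exp (-T) (NormedSpace.exp T x) = x := by
  have h : NormedSpace.exp (-T) * NormedSpace.exp T = 1 := by
    rw [← clm_exp_add_of_commute (Commute.neg_left (Commute.refl T)), neg_add_cancel,
      NormedSpace.exp_zero]
  exact DFunLike.congr_fun h x

theorem star_exp_apply {T T' : A →L[ℂ] A} (h : ∀ x, star (T x) = T' (star x)) (x : A) :
    star (NormedSpace.exp T x) = NormedSpace.exp T' (star x) := by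
  have : ContinuousStar A := ⟨continuous_jstar⟩
  have h1 := (hasSum_exp_apply T x).star
  refine h1.unique ?_
  convert hasSum_exp_apply T' (star x) using 2 with n
  have h2 : ∀ (n : ℕ) (x : A), star ((T ^ n) x) = (T' ^ n) (star x) := by
    intro n
    induction n with
    | zero => simp
    | succ n ih =>
      intro x
      rw [pow_succ, pow_succ, mul_apply_eq_comp, mul_apply_eq_comp, ih, h]
  rw [star_smul, h2]
  simp

theorem triple_exp_smul_jL (a x y : A) (z : ℂ) :
    let X := NormedSpace.exp (z • jL a) x
    let Y := NormedSpace.exp (z • -jL a) y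
    X * Y * X + Y * X * X - X * X * Y =
      NormedSpace.exp (z • jL a) (x * y * x + y * x * x - x * x * y) := by
  intro X Y
  let X' : ℂ → A := fun z => NormedSpace.exp (z • jL a) x
  let Y' : ℂ → A := fun z => NormedSpace.exp (z • -jL a) y
  let W : ℂ → A := fun z => X' z * Y' z * X' z + Y' z * X' z * X' z - X' z * X' z * Y' z
  have hX : ∀ z, HasDerivAt X' (a * X' z) z := hasDerivAt_exp_smul_apply (jL a) x
  have hY : ∀ z, HasDerivAt Y' (-(a * Y' z)) z := hasDerivAt_exp_smul_apply (-jL a) y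
  have hW : ∀ z, HasDerivAt W (a * W z) z := by
    intro z
    have h := ((((hX z).jmul (hY z)).jmul (hX z)).add (((hY z).jmul (hX z)).jmul (hX z))).sub
      (((hX z).jmul (hX z)).jmul (hY z))
    have h' : a * W z = _ := mul_triple a (X' z) (Y' z)
    refine h.congr_deriv ?_
    rw [h']
    simp only [mul_neg, neg_mul, add_mul]
    abel
  have hG : ∀ z, HasDerivAt (fun z => NormedSpace.exp (z • -jL a) (W z)) 0 z := by
    intro z
    have h := (hasDerivAt_exp_smul_const (𝕂 := ℂ) (-jL a) z).clm_apply (hW z)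
    refine h.congr_deriv ?_
    simp
  have hc := is_const_of_deriv_eq_zero (fun z => (hG z).differentiableAt) (fun z => (hG z).deriv) z 0
  have h2 := congrArg (fun w => NormedSpace.exp (z • jL a) w) hc
  have h3 := exp_neg_mul_exp_apply (z • -jL a) (W z)
  simp only [smul_neg, neg_neg, zero_smul, neg_zero, NormedSpace.exp_zero] at h2 h3
  rw [h3] at h2
  simpa [W, X', Y', X, Y] using h2

/-- A bounded operator that commutes with the cubes `{x, x*, x}` is contractive. -/
theorem norm_map_le_of_map_cube {B : Type*} [JBStarAlgebra B] (T : A → B) (C : ℝ)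
    (hC : ∀ x, ‖T x‖ ≤ C * ‖x‖)
    (hT : ∀ x, T (x * star x * x + star x * x * x - x * x * star x) =
      T x * star (T x) * T x + star (T x) * T x * T x - T x * T x * star (T x)) (x : A) :
    ‖T x‖ ≤ ‖x‖ := by
  have key : ∀ (n : ℕ) (x : A), ‖T x‖ ^ 3 ^ n ≤ C * ‖x‖ ^ 3 ^ n := by
    intro n
    induction n with
    | zero => simpa using hC
    | succ n ih =>
      intro x
      have h := ih (x * star x * x + star x * x * x - x * x * star x)
      rw [hT, JBStarAlgebra.norm_triple, JBStarAlgebra.norm_triple, ← pow_mul, ← pow_mul] at h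
      rwa [pow_succ' 3 n]
  by_contra! hlt
  rcases eq_or_lt_of_le (norm_nonneg x) with h0 | h0
  · have := hC x
    rw [← h0] at this hlt
    linarith
  have hq : 1 < ‖T x‖ / ‖x‖ := (one_lt_div h0).2 hlt
  obtain ⟨n, hn⟩ := pow_unbounded_of_one_lt C hq
  have h1 : (‖T x‖ / ‖x‖) ^ n ≤ (‖T x‖ / ‖x‖) ^ 3 ^ n :=
    pow_le_pow_right₀ hq.le (Nat.lt_pow_self (by norm_num)).le
  have h2 : (‖T x‖ / ‖x‖) ^ 3 ^ n ≤ C := by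
    rw [div_pow, div_le_iff₀ (by positivity)]
    exact key n x
  linarith

theorem norm_exp_I_smul_jL_le {a : A} (ha : IsSelfAdjoint a) (s : ℝ) (x : A) :
    ‖NormedSpace.exp ((s * Complex.I) • jL a) x‖ ≤ ‖x‖ := by
  refine norm_map_le_of_map_cube _ ‖NormedSpace.exp ((s * Complex.I) • jL a)‖
    (ContinuousLinearMap.le_opNorm _) (fun x => ?_) x
  have h := triple_exp_smul_jL a x (star x) (s * Complex.I)
  have h2 := star_exp_apply (T := (s * Complex.I) • jL a) (T' := (s * Complex.I) • -jL a)
    (fun x => by simp [star_smul, ha.star_eq]) x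
  rw [← h2] at h
  exact h.symm

end Multiplication

section Positivity

variable {A : Type*} [JBStarAlgebra A] {e : A}

theorem JPos.of_sub_mul (he : ∀ x, e * x = x) {a x y : A} (ha : IsSelfAdjoint a) (ha1 : ‖a‖ < 1)
    (hx : JPos x) (h : y - a * y = x) : JPos y := by
  have hy : IsSelfAdjoint y := by
    have h1 : star y - a * star y = x := by
      rw [← hx.isSelfAdjoint.star_eq, ← h, star_sub, star_jmul, ha.star_eq]
    have h2 : star y - y = a * (star y - y) := by
      rw [mul_sub, ← sub_eq_zero]
      rw [← h, ← sub_eq_zero] at h1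
      rw [← h1]; abel
    have h3 := JBStarAlgebra.norm_jmul_le a (star y - y)
    rw [← h2] at h3
    have h4 : ‖star y - y‖ = 0 := by nlinarith [norm_nonneg (star y - y)]
    exact sub_eq_zero.1 (norm_eq_zero.1 h4)
  by_cases he0 : e = 0
  · have : y = 0 := by rw [← he y, he0, zero_mul]
    rw [this]; exact jpos_zero
  obtain ⟨m, ρ, hρ, hρe, hp, hm⟩ := exists_state_eq_lower_bound he he0 hy
  have h0 : (ρ (y - (m : ℂ) • e)).re = 0 := by simp [hm, hρe]
  have h1 := state_mul_eq_zero_of_jpos he hρ hρe ha hp h0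
  have h2 : ρ (a * y) = m * ρ a := by
    rw [mul_sub, mul_smul_comm, mul_comm a e, he, map_sub, map_smul, sub_eq_zero] at h1
    simpa using h1
  have h3 := state_re_nonneg he hρ hρe hx
  rw [← h, map_sub, h2, hm] at h3
  simp at h3
  have h4 := (Complex.re_le_norm _).trans (hρ a)
  have h5 : 0 ≤ m := by
    by_contra! hm0
    nlinarith
  have := hp.add he ((jpos_junit he).smul h5)
  rwa [sub_add_cancel] at this

theorem JPos.exp_apply (he : ∀ x, e * x = x) {T : A →L[ℂ] A} (hT : ∀ x, JPos x → JPos (T x))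
    {x : A} (hx : JPos x) : JPos (NormedSpace.exp T x) := by
  have h := hasSum_exp_apply T x
  refine (isClosed_jpos he).mem_of_tendsto h (Filter.Eventually.of_forall fun s => ?_)
  refine Finset.sum_induction _ JPos (fun a b ha hb => ha.add he hb) jpos_zero fun n _ => ?_
  have hn : ∀ n : ℕ, JPos ((T ^ n) x) := by
    intro n
    induction n with
    | zero => simpa using hx
    | succ n ih => rw [pow_succ']; exact hT _ ih
  have := (hn n).smul (r := (n.factorial : ℝ)⁻¹) (by positivity)
  simpa using this

/-- The exponential of a multiplication operator is positive. -/
theorem JPos.exp_jL (he : ∀ x, e * x = x) {a : A} (ha : IsSelfAdjoint a) {x : A} (hx : JPos x) :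
    JPos (NormedSpace.exp (jL a) x) := by
  let R : ℝ → (A →L[ℂ] A) := fun ε => Ring.inverse (1 - (ε : ℂ) • jL a)
  have hcont : Filter.Tendsto (fun ε : ℝ => jL a * R ε) (𝓝[>] 0) (𝓝 (jL a)) := by
    have h1 : ContinuousAt R 0 := by
      refine ContinuousAt.comp (g := Ring.inverse) (f := fun ε : ℝ => 1 - (ε : ℂ) • jL a) ?_
        (by fun_prop)
      have := NormedRing.inverse_continuousAt (1 : (A →L[ℂ] A)ˣ)
      simpa using this
    have h2 : Filter.Tendsto (fun ε : ℝ => jL a * R ε) (𝓝 0) (𝓝 (jL a * R 0)) :=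
      (h1.const_mul (jL a) :)
    simp only [R, Complex.ofReal_zero, zero_smul, sub_zero, Ring.inverse_one, mul_one] at h2
    exact h2.mono_left nhdsWithin_le_nhds
  have hpos : ∀ᶠ ε in 𝓝[>] (0 : ℝ), JPos (NormedSpace.exp (jL a * R ε) x) := by
    have hs : ∀ᶠ ε in 𝓝[>] (0 : ℝ), ε * ‖a‖ < 1 := by
      have : Filter.Tendsto (fun ε : ℝ => ε * ‖a‖) (𝓝[>] 0) (𝓝 (0 * ‖a‖)) :=
        (Filter.tendsto_id.mul_const _).mono_left nhdsWithin_le_nhds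
      exact this.eventually_lt_const (by simp)
    filter_upwards [hs, self_mem_nhdsWithin] with ε hε hε0
    have hε0 : 0 < ε := hε0
    have hu : IsUnit (1 - (ε : ℂ) • jL a) := by
      refine isUnit_one_sub_of_norm_lt_one ?_
      rw [norm_smul, Complex.norm_real, Real.norm_of_nonneg hε0.le]
      exact (mul_le_mul_of_nonneg_left (norm_jL_le a) hε0.le).trans_lt hε
    have hR : (1 - (ε : ℂ) • jL a) * R ε = 1 := Ring.mul_inverse_cancel _ hu
    have hRpos : ∀ x, JPos x → JPos (R ε x) := by
      intro x hx
      refine JPos.of_sub_mul he (a := (ε : ℂ) • a) (isSelfAdjoint_ofReal_smul ha ε) ?_ hx ?_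
      · rwa [norm_smul, Complex.norm_real, Real.norm_of_nonneg hε0.le]
      · have := DFunLike.congr_fun hR x
        simpa [smul_mul_assoc] using this
    have heq : jL a * R ε =
        ((ε⁻¹ : ℝ) : ℂ) • R ε + algebraMap ℂ (A →L[ℂ] A) ((-ε⁻¹ : ℝ) : ℂ) := by
      have h1 : (ε : ℂ) • (jL a * R ε) = R ε - 1 := by
        rw [← hR, sub_mul, one_mul, smul_mul_assoc]; abel
      have h2 : jL a * R ε = ((ε⁻¹ : ℝ) : ℂ) • (R ε - 1) := by
        rw [← h1, smul_smul, ← Complex.ofReal_mul, inv_mul_cancel₀ hε0.ne']; simp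
      rw [h2, smul_sub, Algebra.algebraMap_eq_smul_one, Complex.ofReal_neg, neg_smul]; abel
    rw [heq, clm_exp_add_of_commute (Algebra.commute_algebraMap_right _ _),
      ← NormedSpace.algebraMap_exp_comm, ← Complex.exp_eq_exp_ℂ, ← Complex.ofReal_exp,
      Algebra.algebraMap_eq_smul_one, mul_smul_comm, mul_one]
    refine JPos.smul (JPos.exp_apply he (fun x hx => ?_) hx) (Real.exp_pos _).le
    exact (hRpos x hx).smul (inv_nonneg.2 hε0.le)
  refine (isClosed_jpos he).mem_of_tendsto ?_ hpos
  exact ((ContinuousLinearMap.apply ℂ A x).continuous.comp clm_exp_continuous).tendsto _ |>.comp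
    hcont

end Positivity

section Projection

variable {A : Type*} [JBStarAlgebra A] {e : A}

theorem exp_apply_mem {N : Submodule ℂ A} (hN : IsClosed (N : Set A)) {T : A →L[ℂ] A}
    (hT : ∀ x ∈ N, T x ∈ N) {x : A} (hx : x ∈ N) : NormedSpace.exp T x ∈ N := by
  refine hN.mem_of_tendsto (hasSum_exp_apply T x) (Filter.Eventually.of_forall fun s => ?_)
  refine N.sum_mem fun n hn => N.smul_mem _ ?_
  clear hn
  induction n with
  | zero => simpa using hx
  | succ n ih => rw [pow_succ', mul_apply_eq_comp]; exact hT _ ih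

/-- The conjugates of a unital contractive projection by the exponential of a multiplication
operator that leaves the range invariant are bounded, uniformly. -/
theorem norm_exp_conj_projection_le (he : ∀ x, e * x = x) {N : Submodule ℂ A}
    (hN : IsClosed (N : Set A)) (heN : e ∈ N) {E : A →L[ℂ] A} (hE : ∀ x, ‖E x‖ ≤ ‖x‖)
    (hEN : ∀ x ∈ N, E x = x) {n : A} (hn : IsSelfAdjoint n) (hnN : ∀ x ∈ N, n * x ∈ N) (x : A) :
    ‖NormedSpace.exp (-jL n) (E (NormedSpace.exp (jL n) x))‖ ≤ 2 * ‖x‖ := by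
  let Q : A →L[ℂ] A := NormedSpace.exp (-jL n) * E * NormedSpace.exp (jL n)
  have hQe : Q e = e := by
    change NormedSpace.exp (-jL n) (E (NormedSpace.exp (jL n) e)) = e
    rw [hEN _ (exp_apply_mem hN hnN heN), exp_neg_mul_exp_apply]
  have hQ : ∀ x, JPos x → JPos (Q x) := by
    intro x hx
    have h1 := (hx.exp_jL he hn).map_of_contractive he he E.toLinearMap hE (hEN e heN)
    have h2 := h1.exp_jL he hn.neg
    rwa [map_neg] at h2
  have hsa : ∀ x, IsSelfAdjoint x → ‖Q x‖ ≤ ‖x‖ := by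
    intro x hx
    have h1 := hQ _ (jpos_sub_of_norm_le he hx le_rfl)
    have h2 := hQ _ (jpos_add_of_norm_le he hx le_rfl)
    rw [map_sub, map_smul, hQe] at h1
    rw [map_add, map_smul, hQe] at h2
    refine norm_le_of_jpos he ?_ (norm_nonneg x) h1 h2
    have h3 := h2.isSelfAdjoint.sub
      (isSelfAdjoint_ofReal_smul (junit_isSelfAdjoint he) ‖x‖)
    rwa [add_sub_cancel_left] at h3
  obtain ⟨u, v, hu, hv, huv, h1, h2, -⟩ := exists_re_im x
  have h3 : Q x = Q u + Complex.I • Q v := by rw [huv, map_add, map_smul]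
  change ‖Q x‖ ≤ _
  rw [h3]
  refine (norm_add_le _ _).trans ?_
  rw [norm_smul, Complex.norm_I, one_mul]
  linarith [hsa u hu, hsa v hv]

/-- A contractive projection onto a unital closed subalgebra is a module map. -/
theorem contractive_projection_mul_of_isSelfAdjoint (he : ∀ x, e * x = x) {N : Submodule ℂ A}
    (hN : IsClosed (N : Set A)) (hmul : ∀ x ∈ N, ∀ y ∈ N, x * y ∈ N) (heN : e ∈ N)
    {E : A →L[ℂ] A} (hE : ∀ x, ‖E x‖ ≤ ‖x‖) (hEN : ∀ x ∈ N, E x = x) {n : A}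
    (hn : IsSelfAdjoint n) (hnN : n ∈ N) (k : A) : E (n * k) = n * E k := by
  let f : ℂ → A := fun z => NormedSpace.exp (z • -jL n) (E (NormedSpace.exp (z • jL n) k))
  have hbound : ∀ z, ‖f z‖ ≤ 2 * ‖k‖ := by
    intro z
    have hz : z = (z.re : ℂ) + z.im * Complex.I := (Complex.re_add_im z).symm
    have hL : z • jL n = (z.im * Complex.I) • jL n + jL ((z.re : ℂ) • n) := by
      rw [map_smul, ← add_smul, add_comm, ← hz]
    have hc : Commute ((z.im * Complex.I) • jL n) (jL ((z.re : ℂ) • n)) := by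
      rw [map_smul]
      exact ((Commute.refl (jL n)).smul_left _).smul_right _
    have hc' : Commute (jL ((z.re : ℂ) • n)) ((z.im * Complex.I) • jL n) := hc.symm
    have h1 : NormedSpace.exp (z • jL n) =
        NormedSpace.exp (jL ((z.re : ℂ) • n)) * NormedSpace.exp ((z.im * Complex.I) • jL n) := by
      rw [← clm_exp_add_of_commute hc', hL, add_comm]
    have h2 : NormedSpace.exp (z • -jL n) =
        NormedSpace.exp (((-z.im : ℝ) * Complex.I) • jL n) *
          NormedSpace.exp (-jL ((z.re : ℂ) • n)) := by
      have h3 : ((-z.im : ℝ) * Complex.I) • jL n = -((z.im * Complex.I) • jL n) := by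
        push_cast; rw [neg_mul, neg_smul]
      rw [h3, ← clm_exp_add_of_commute (hc.neg_left.neg_right), smul_neg, hL, neg_add]
    change ‖NormedSpace.exp (z • -jL n) (E (NormedSpace.exp (z • jL n) k))‖ ≤ _
    rw [h1, h2, mul_apply_eq_comp, mul_apply_eq_comp]
    refine (norm_exp_I_smul_jL_le hn _ _).trans ?_
    refine (norm_exp_conj_projection_le he hN heN hE hEN (isSelfAdjoint_ofReal_smul hn z.re)
      (fun x hx => ?_) _).trans ?_
    · rw [smul_mul_assoc]; exact N.smul_mem _ (hmul n hnN x hx)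
    · exact mul_le_mul_of_nonneg_left (norm_exp_I_smul_jL_le hn _ _) zero_le_two
  have hd : ∀ z, HasDerivAt f (NormedSpace.exp (z • -jL n)
      (E (n * NormedSpace.exp (z • jL n) k) - n * E (NormedSpace.exp (z • jL n) k))) z := by
    intro z
    have h := (hasDerivAt_exp_smul_const (𝕂 := ℂ) (-jL n) z).clm_apply
      (E.hasFDerivAt.comp_hasDerivAt z (hasDerivAt_exp_smul_apply (jL n) k z))
    refine h.congr_deriv ?_
    simp only [mul_apply_eq_comp, map_sub, neg_apply, jL_apply, map_neg, Function.comp]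
    abel
  have hconst : ∀ z, f z = f 0 := fun z =>
    Differentiable.apply_eq_apply_of_bounded (fun z => (hd z).differentiableAt)
      (isBounded_iff_forall_norm_le.2 ⟨2 * ‖k‖, by rintro _ ⟨z, rfl⟩; exact hbound z⟩) z 0
  have h0 : HasDerivAt f 0 0 := by
    rw [show f = fun _ => f 0 from funext hconst]
    exact hasDerivAt_const _ _
  have h1 := (hd 0).unique h0
  simpa [NormedSpace.exp_zero, sub_eq_zero] using h1

theorem contractive_projection_mul (he : ∀ x, e * x = x) {N : Submodule ℂ A}
    (hN : IsClosed (N : Set A)) (hmul : ∀ x ∈ N, ∀ y ∈ N, x * y ∈ N)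
    (hstar : ∀ x ∈ N, star x ∈ N) (heN : e ∈ N)
    {E : A →L[ℂ] A} (hE : ∀ x, ‖E x‖ ≤ ‖x‖) (hEN : ∀ x ∈ N, E x = x) {n : A}
    (hnN : n ∈ N) (k : A) : E (n * k) = n * E k := by
  obtain ⟨u, v, hu, hv, huv, -, -, hu'⟩ := exists_re_im n
  have huN : u ∈ N := hu' ▸ N.smul_mem _ (add_mem hnN (hstar n hnN))
  have hvN : v ∈ N := by
    have : v = (-Complex.I) • (n - u) := by
      rw [huv, add_sub_cancel_left, smul_smul]; simp
    rw [this]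
    exact N.smul_mem _ (sub_mem hnN huN)
  have h1 := contractive_projection_mul_of_isSelfAdjoint he hN hmul heN hE hEN hu huN k
  have h2 := contractive_projection_mul_of_isSelfAdjoint he hN hmul heN hE hEN hv hvN k
  rw [huv, add_mul, add_mul, smul_mul_assoc, smul_mul_assoc, map_add, map_smul, h1, h2]

end Projection

section Unit

variable {A : Type*} [JBStarAlgebra A]

/-- The continuous functional calculus of a selfadjoint element. -/
theorem exists_functional_calculus {a : A} (ha : IsSelfAdjoint a) :
    ∃ Φ : (ℝ → ℝ) → A, Φ id = a ∧ (∀ f, IsSelfAdjoint (Φ f)) ∧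
      (∀ f g, Continuous f → f 0 = 0 → Continuous g → g 0 = 0 →
        Φ (fun x => f x + g x) = Φ f + Φ g ∧ Φ (fun x => f x - g x) = Φ f - Φ g ∧
        Φ (fun x => f x * g x) = Φ f * Φ g) ∧
      (∀ f C, (∀ x, |x| ≤ ‖a‖ → |f x| ≤ C) → ‖Φ f‖ ≤ C) ∧
      (∀ f, Continuous f → f 0 = 0 → (∀ x, |x| ≤ ‖a‖ → 0 ≤ f x) → JPos (Φ f)) := by
  obtain ⟨S, haS⟩ := exists_closedAssocSub ha
  have hx : IsSelfAdjoint (⟨a, haS⟩ : S.Elem) := Subtype.ext ha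
  have hq : ∀ x ∈ quasispectrum ℝ (⟨a, haS⟩ : S.Elem), |x| ≤ ‖a‖ := fun x hx' =>
    NonUnitalIsometricContinuousFunctionalCalculus.norm_quasispectrum_le _ hx' hx
  refine ⟨fun f => ((cfcₙ f (⟨a, haS⟩ : S.Elem) : S.Elem) : A), ?_, ?_, ?_, ?_, ?_⟩
  · simp only [cfcₙ_id ℝ _ hx]
  · exact fun f => (S.isSelfAdjoint_iff _).1 (cfcₙ_predicate f (⟨a, haS⟩ : S.Elem))
  · intro f g hf hf0 hg hg0
    refine ⟨?_, ?_, ?_⟩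
    · simp only [cfcₙ_add f g (a := (⟨a, haS⟩ : S.Elem)) hf.continuousOn hf0 hg.continuousOn hg0]
      rfl
    · simp only [cfcₙ_sub f g (a := (⟨a, haS⟩ : S.Elem)) hf.continuousOn hf0 hg.continuousOn hg0]
      rfl
    · simp only [cfcₙ_mul f g (a := (⟨a, haS⟩ : S.Elem)) hf.continuousOn hf0 hg.continuousOn hg0]
      rfl
  · intro f C h
    exact norm_cfcₙ_le fun x hx => h x (hq x hx)
  · intro f hf hf0 h
    refine ⟨((cfcₙ (fun x => √(f x)) (⟨a, haS⟩ : S.Elem) : S.Elem) : A),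
      (S.isSelfAdjoint_iff _).1 (cfcₙ_predicate _ (⟨a, haS⟩ : S.Elem)), ?_⟩
    rw [← ClosedAssocSub.coe_mul, ← cfcₙ_mul _ _ _ (by fun_prop) (by simp [hf0]) (by fun_prop)
      (by simp [hf0])]
    congr 1
    exact cfcₙ_congr fun x hx => Real.mul_self_sqrt (h x (hq x hx))

theorem norm_jmul_self {a : A} (ha : IsSelfAdjoint a) : ‖a * a‖ = ‖a‖ ^ 2 := by
  obtain ⟨S, haS⟩ := exists_closedAssocSub ha
  have hx : IsSelfAdjoint (⟨a, haS⟩ : S.Elem) := Subtype.ext ha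
  have h := CStarRing.norm_star_mul_self (x := (⟨a, haS⟩ : S.Elem))
  rw [hx.star_eq, ← pow_two] at h
  exact h

/-- A linear property of a kernel may be checked on the selfadjoint elements. -/
theorem eq_zero_of_forall_isSelfAdjoint (T : A →ₗ[ℂ] A) (hT : ∀ x, star (T x) = T (star x))
    (h : ∀ x, IsSelfAdjoint x → T x = 0 → x = 0) (x : A) (hx : T x = 0) : x = 0 := by
  obtain ⟨u, v, hu, hv, huv, -, -, hu'⟩ := exists_re_im x
  have h1 : T u = 0 := by rw [hu', map_smul, map_add, ← hT, hx]; simp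
  have h2 : T v = 0 := by
    rw [huv, map_add, h1, zero_add, map_smul] at hx
    exact (smul_eq_zero.1 hx).resolve_left Complex.I_ne_zero
  rw [huv, h u hu h1, h v hv h2]; simp

section Peirce

variable {e : A}

theorem peirce_identity (hee : e * e = e) (x : A) :
    (2 : ℂ) • (e * (e * (e * x))) - (3 : ℂ) • (e * (e * x)) + e * x = 0 := by
  have h := jordan_linearized e e x e
  rw [hee, hee, mul_comm x e, mul_comm (e * x) e] at h
  linear_combination (norm := module) (1 : ℂ) • h

theorem mul_sq_eq_zero_of_mul_eq_zero (hee : e * e = e) {y : A} (hy : e * y = 0) :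
    e * (y * y) = 0 := by
  have h := jordan_linearized y e e y
  rw [hee, mul_comm y e, hy] at h
  simpa using h.symm

theorem norm_add_le_one_of_mul_eq_zero (hee : e * e = e) (hse : IsSelfAdjoint e) (he1 : ‖e‖ ≤ 1)
    {v : A} (hv : IsSelfAdjoint v) (hev : e * v = 0) (hv1 : ‖v‖ ≤ 1) : ‖e + v‖ ≤ 1 := by
  have key : ∀ (n : ℕ) (v : A), IsSelfAdjoint v → e * v = 0 → ‖v‖ ≤ 1 → ‖e + v‖ ^ 2 ^ n ≤ 2 := by
    intro n
    induction n with
    | zero =>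
      intro v _ _ hv1
      rw [pow_zero, pow_one]
      linarith [norm_add_le e v]
    | succ n ih =>
      intro v hv hev hv1
      have h := ih (v * v) (hv.jmul hv) (mul_sq_eq_zero_of_mul_eq_zero hee hev)
        (by rw [norm_jmul_self hv]; exact pow_le_one₀ (norm_nonneg _) hv1)
      have h2 : e + v * v = (e + v) * (e + v) := by
        rw [add_mul, mul_add, mul_add, hee, mul_comm v e, hev]; simp
      rwa [h2, norm_jmul_self (hse.add hv), ← pow_mul, ← pow_succ'] at h
  by_contra! hlt
  obtain ⟨n, hn⟩ := pow_unbounded_of_one_lt 2 hlt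
  have h1 := pow_le_pow_right₀ hlt.le (Nat.lt_pow_self (n := n) (one_lt_two)).le
  linarith [key n v hv hev hv1]

/-- An idempotent whose Peirce `0`-space is trivial is a unit. -/
theorem junit_of_peirce_zero (hee : e * e = e) (hse : IsSelfAdjoint e)
    (h0 : ∀ y, e * y = 0 → y = 0) (x : A) : e * x = x := by
  have hq : ∀ z, (2 : ℂ) • (e * (e * z)) - (3 : ℂ) • (e * z) + z = 0 := by
    intro z
    refine h0 _ ?_
    rw [mul_add, mul_sub, mul_smul_comm, mul_smul_comm]
    exact peirce_identity hee z
  have hhalf : ∀ w, IsSelfAdjoint w → e * w - (1 / 2 : ℂ) • w = 0 → w = 0 := by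
    intro w hw hew
    rw [sub_eq_zero] at hew
    have h1 : e * (e * (w * w)) = e * (w * w) := by
      have h := jordan_linearized e w w e
      rw [mul_comm w e, hew, hee, mul_comm (w * w) e, mul_comm ((1 / 2 : ℂ) • w) e, mul_smul_comm,
        hew, mul_smul_comm, mul_smul_comm, smul_mul_smul_comm] at h
      linear_combination (norm := module) (1 : ℂ) • h
    have h2 : e * (w * w) = w * w := by
      have h := hq (w * w)
      rw [h1] at h
      linear_combination (norm := module) (-1 : ℂ) • h
    have h3 := IsJordan.lmul_lmul_comm_lmul w e
    rw [mul_comm w e, hew, mul_comm (w * w) e, h2, mul_smul_comm, mul_comm w (w * w)] at h3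
    have h4 : w * w * w = 0 := by
      linear_combination (norm := module) (-2 : ℂ) • h3
    have h5 := JBStarAlgebra.norm_triple w
    rw [hw.star_eq, h4] at h5
    simpa using h5.symm
  have hw := eq_zero_of_forall_isSelfAdjoint (LinearMap.mul ℂ A e - (1 / 2 : ℂ) • LinearMap.id)
    (fun x => by simp [star_smul, hse.star_eq]) hhalf (e * x - x) (by
      have h := hq x
      simp only [LinearMap.sub_apply, LinearMap.mul_apply', LinearMap.smul_apply, LinearMap.id_apply,
        mul_sub]
      linear_combination (norm := module) (1 / 2 : ℂ) • h)
  exact sub_eq_zero.1 hw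

end Peirce

end Unit

section JBW

variable {M : Type*} [JBStarAlgebra M] {F : Submodule ℂ (StrongDual ℂ M)} {φ : StrongDual ℂ M}

theorem IsPredual.exists_apply_eq_norm (hF : IsPredual F) (hφ : φ ∈ F) (h0 : φ ≠ 0) :
    ∃ x : M, ‖x‖ = 1 ∧ φ x = ‖φ‖ := by
  let ψ : Pre F := ⟨φ, hφ⟩
  have hψ : ψ ≠ 0 := fun h => h0 (congrArg Subtype.val h)
  obtain ⟨g, hg1, hg2⟩ := exists_dual_vector ℂ ψ (norm_ne_zero_iff.2 hψ)
  obtain ⟨x, hx⟩ := hF.surjective g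
  refine ⟨x, by rw [← hF.isometry, hx, hg1], ?_⟩
  rw [← hx] at hg2
  exact hg2

theorem IsNormalFaithfulState.norm_apply_le (hφ : IsNormalFaithfulState F φ) (x : M) :
    ‖φ x‖ ≤ ‖x‖ := by
  simpa [hφ.norm_eq_one] using φ.le_opNorm x

theorem IsNormalFaithfulState.re_nonneg (hφ : IsNormalFaithfulState F φ) {x : M} (hx : JPos x) :
    0 ≤ (φ x).re := by
  obtain ⟨s, hs, rfl⟩ := hx
  exact (hφ.nonneg s hs).1

theorem IsNormalFaithfulState.eq_zero (hφ : IsNormalFaithfulState F φ) {x : M} (hx : JPos x)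
    (h : (φ x).re = 0) : x = 0 := by
  obtain ⟨s, hs, rfl⟩ := hx
  exact hφ.faithful s hs (Complex.ext h (hφ.nonneg s hs).2)

/-- A JBW*-algebra with a normal faithful state is unital. -/
theorem exists_junit (hF : IsPredual F) (hφ : IsNormalFaithfulState F φ) :
    ∃ e : M, (∀ x, e * x = x) ∧ φ e = 1 := by
  obtain ⟨x, hx1, hx2⟩ := hF.exists_apply_eq_norm hφ.normal (by
    intro h
    have := hφ.norm_eq_one
    rw [h] at this
    simp at this)
  rw [hφ.norm_eq_one] at hx2
  have him : ∀ a : M, IsSelfAdjoint a → (φ a).im = 0 := by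
    intro a ha
    obtain ⟨Φ, hΦ, -, hadd, -, hpos⟩ := exists_functional_calculus ha
    have h1 := (hadd (fun x => max x 0) (fun x => max (-x) 0) (by fun_prop) (by simp)
      (by fun_prop) (by simp)).2.1
    have h2 : (fun x : ℝ => max x 0 - max (-x) 0) = id := by
      ext x
      rcases le_total x 0 with h | h <;> simp [h]
    obtain ⟨s, hs, hs'⟩ := hpos (fun x => max x 0) (by fun_prop) (by simp) (fun x _ => le_max_right _ _)
    obtain ⟨t, ht, ht'⟩ := hpos (fun x => max (-x) 0) (by fun_prop) (by simp) (fun x _ => le_max_right _ _)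
    rw [h2, hΦ, ← hs', ← ht'] at h1
    rw [h1, map_sub, Complex.sub_im, (hφ.nonneg s hs).2, (hφ.nonneg t ht).2, sub_zero]
  obtain ⟨u, v, hu, hv, huv, hu1, -, -⟩ := exists_re_im x
  have hφu : (φ u).re = 1 := by
    rw [huv, map_add, map_smul] at hx2
    have := congrArg Complex.re hx2
    simpa [him v hv] using this
  rw [hx1] at hu1
  obtain ⟨Φ, hΦ, hsa, hadd, hnorm, hpos⟩ := exists_functional_calculus hu
  set e := Φ (fun x => |x|) with he_def
  have hse : IsSelfAdjoint e := hsa _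
  have hsq := (hadd (fun x => |x|) (fun x => |x|) (by fun_prop) (by simp) (by fun_prop) (by simp))
  have hu1' : ∀ x, |x| ≤ ‖u‖ → |x| ≤ 1 := fun x hx => hx.trans hu1
  have he1 : ‖e‖ ≤ 1 := hnorm _ 1 fun x hx => by simpa using hu1' x hx
  have h1 : JPos (e - u) := by
    have h := (hadd (fun x => |x|) id (by fun_prop) (by simp) continuous_id rfl).2.1
    rw [hΦ] at h
    rw [← h]
    exact hpos _ (by fun_prop) (by simp) fun x _ => sub_nonneg.2 (le_abs_self x)
  have h2 : JPos (e - e * e) := by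
    have h := (hadd (fun x => |x|) (fun x => |x| * |x|) (by fun_prop) (by simp) (by fun_prop)
      (by simp)).2.1
    rw [hsq.2.2] at h
    rw [← h]
    refine hpos _ (by fun_prop) (by simp) fun x hx => ?_
    nlinarith [hu1' x hx, abs_nonneg x]
  have h3 : ‖e + e - e * e‖ ≤ 1 := by
    have h := (hadd (fun x => |x| + |x|) (fun x => |x| * |x|) (by fun_prop) (by simp) (by fun_prop)
      (by simp)).2.1
    rw [hsq.2.2, hsq.1] at h
    rw [← h]
    refine hnorm _ 1 fun x hx => ?_
    rw [abs_le]
    constructor <;> nlinarith [hu1' x hx, abs_nonneg x, sq_nonneg (|x| - 1)]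
  have h4 := hφ.re_nonneg h1
  have h5 := hφ.re_nonneg h2
  have h6 := (Complex.re_le_norm _).trans ((hφ.norm_apply_le _).trans h3)
  have h7 := (Complex.re_le_norm _).trans ((hφ.norm_apply_le _).trans he1)
  have h8 : e - e * e = 0 := hφ.eq_zero h2 (by simp at h4 h5 h6 ⊢; linarith)
  have hee : e * e = e := (sub_eq_zero.1 h8).symm
  have hφe : (φ e).re = 1 := by simp at h4; linarith
  refine ⟨e, junit_of_peirce_zero hee hse ?_, Complex.ext hφe (by simpa using him e hse)⟩
  refine eq_zero_of_forall_isSelfAdjoint (LinearMap.mul ℂ M e)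
    (fun x => by simp [hse.star_eq, mul_comm]) fun y hy hey => ?_
  by_contra hy0
  have hn : ‖y‖ ≠ 0 := norm_ne_zero_iff.2 hy0
  set w : M := ((‖y‖⁻¹ : ℝ) : ℂ) • y with hw
  have hsw : IsSelfAdjoint w := isSelfAdjoint_ofReal_smul hy _
  have hew : e * w = 0 := by rw [hw, mul_smul_comm]; simpa using Or.inr hey
  have hw1 : ‖w‖ = 1 := by
    rw [hw, norm_smul, Complex.norm_real, Real.norm_of_nonneg (by positivity), inv_mul_cancel₀ hn]
  have h9 := norm_add_le_one_of_mul_eq_zero hee hse he1 (hsw.jmul hsw)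
    (mul_sq_eq_zero_of_mul_eq_zero hee hew) (by rw [norm_jmul_self hsw, hw1]; simp)
  have h10 := (Complex.re_le_norm _).trans ((hφ.norm_apply_le _).trans h9)
  rw [map_add, Complex.add_re, hφe] at h10
  have h11 := hφ.eq_zero ⟨w, hsw, rfl⟩ (le_antisymm (by linarith) (hφ.re_nonneg ⟨w, hsw, rfl⟩))
  have h12 := norm_jmul_self hsw
  rw [h11, hw1] at h12
  simp at h12

end JBW

section BoundedFamilies

variable {I M : Type*} [JBStarAlgebra M]

/-- The bounded families of elements of a JB*-algebra. -/
abbrev BoundedFamily (I M : Type*) [JBStarAlgebra M] : Type _ := lp (fun _ : I => M) ⊤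

namespace BoundedFamily

/-- The family with given bounded coordinates. -/
def mk (x : I → M) (C : ℝ) (h : ∀ i, ‖x i‖ ≤ C) : BoundedFamily I M :=
  ⟨x, memℓp_infty ⟨C, by rintro _ ⟨i, rfl⟩; exact h i⟩⟩

theorem norm_coord_le (x : BoundedFamily I M) (i : I) : ‖x i‖ ≤ ‖x‖ :=
  lp.norm_apply_le_norm ENNReal.top_ne_zero x i

noncomputable instance : Mul (BoundedFamily I M) where
  mul x y := mk (fun i => x i * y i) (‖x‖ * ‖y‖) fun i =>
    (JBStarAlgebra.norm_jmul_le _ _).trans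
      (mul_le_mul (norm_coord_le x i) (norm_coord_le y i) (norm_nonneg _) (norm_nonneg _))

noncomputable instance : Star (BoundedFamily I M) where
  star x := mk (fun i => star (x i)) ‖x‖ fun i => by
    rw [JBStarAlgebra.norm_jstar]; exact norm_coord_le x i

theorem star_coord (x : BoundedFamily I M) (i : I) : (star x) i = star (x i) := rfl

theorem norm_le {x : BoundedFamily I M} {C : ℝ} (hC : 0 ≤ C) (h : ∀ i, ‖x i‖ ≤ C) : ‖x‖ ≤ C :=
  lp.norm_le_of_forall_le hC h

noncomputable instance : JBStarAlgebra (BoundedFamily I M) where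
  left_distrib x y z := lp.ext (funext fun i => mul_add (x i) (y i) (z i))
  right_distrib x y z := lp.ext (funext fun i => add_mul (x i) (y i) (z i))
  zero_mul x := lp.ext (funext fun i => zero_mul (x i))
  mul_zero x := lp.ext (funext fun i => mul_zero (x i))
  mul_comm x y := lp.ext (funext fun i => mul_comm (x i) (y i))
  star_involutive x := lp.ext (funext fun i => star_star (x i))
  star_mul x y := lp.ext (funext fun i => star_mul (x i) (y i))
  star_add x y := lp.ext (funext fun i => star_add (x i) (y i))
  complete := CompleteSpace.complete
  __ := (inferInstance : NormedSpace ℂ (BoundedFamily I M))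
  smul_assoc c x y := lp.ext (funext fun i => smul_mul_assoc c (x i) (y i))
  smul_comm c x y := lp.ext (funext fun i => (mul_smul_comm c (x i) (y i)).symm)
  star_smul c x := lp.ext (funext fun i => star_smul c (x i))
  lmul_comm_rmul_rmul x y :=
    lp.ext (funext fun i => IsCommJordan.lmul_comm_rmul_rmul (x i) (y i))
  norm_jmul_le x y := norm_le (by positivity) fun i => (JBStarAlgebra.norm_jmul_le _ _).trans
      (mul_le_mul (norm_coord_le x i) (norm_coord_le y i) (norm_nonneg _) (norm_nonneg _))
  norm_jstar x := by
    have h : ∀ y : BoundedFamily I M, ‖star y‖ ≤ ‖y‖ := fun y =>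
      norm_le (norm_nonneg y) fun i => by
        rw [star_coord, JBStarAlgebra.norm_jstar]; exact norm_coord_le y i
    refine le_antisymm (h x) ?_
    have h2 : star (star x) = x := lp.ext (funext fun i => star_star (x i))
    simpa [h2] using h (star x)
  norm_triple x := by
    set y : BoundedFamily I M := x * star x * x + star x * x * x - x * x * star x
    have hy : ∀ i, ‖y i‖ = ‖x i‖ ^ 3 := fun i => JBStarAlgebra.norm_triple (x i)
    refine le_antisymm (norm_le (by positivity) fun i => ?_) ?_
    · rw [hy]
      exact pow_le_pow_left₀ (norm_nonneg _) (norm_coord_le x i) 3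
    · have h : ‖x‖ ≤ ‖y‖ ^ (3⁻¹ : ℝ) := by
        refine norm_le (by positivity) fun i => ?_
        rw [Real.le_rpow_inv_iff_of_pos (norm_nonneg _) (norm_nonneg _) (by norm_num)]
        have := norm_coord_le y i
        rw [hy] at this
        exact_mod_cast this
      calc ‖x‖ ^ 3 ≤ (‖y‖ ^ (3⁻¹ : ℝ)) ^ 3 := by gcongr
        _ = ‖y‖ := by
          rw [← Real.rpow_natCast, ← Real.rpow_mul (norm_nonneg y)]
          norm_num

/-- The constant families. -/
noncomputable def const : M →ₗ[ℂ] BoundedFamily I M where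
  toFun m := mk (fun _ => m) ‖m‖ fun _ => le_rfl
  map_add' _ _ := rfl
  map_smul' _ _ := rfl

theorem norm_const_le (m : M) : ‖(const m : BoundedFamily I M)‖ ≤ ‖m‖ :=
  norm_le (norm_nonneg m) fun _ => le_rfl

end BoundedFamily

end BoundedFamilies

section WeakStar

variable {I M : Type*} [JBStarAlgebra M] {F : Submodule ℂ (StrongDual ℂ M)}

theorem IsPredual.ext (hF : IsPredual F) {x y : M} (h : ∀ ψ ∈ F, ψ x = ψ y) : x = y := by
  rw [← sub_eq_zero, ← norm_eq_zero, ← hF.isometry, norm_eq_zero]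
  ext ψ
  have := h (Pre.toDual F ψ) ψ.2
  simp [ContinuousLinearMap.flip_apply, this]

/-- Bounded families have weak* limits along ultrafilters. -/
theorem IsPredual.exists_limit (hF : IsPredual F) (U : Ultrafilter I) (x : BoundedFamily I M) :
    ∃ m : M, ‖m‖ ≤ ‖x‖ ∧ ∀ ψ ∈ F, Filter.Tendsto (fun i => ψ (x i)) U (𝓝 (ψ m)) := by
  have hb : ∀ (ψ : Pre F) (i : I), ‖Pre.toDual F ψ (x i)‖ ≤ ‖x‖ * ‖ψ‖ := by
    intro ψ i
    refine ((Pre.toDual F ψ).le_opNorm (x i)).trans ?_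
    rw [mul_comm]
    exact mul_le_mul_of_nonneg_right (BoundedFamily.norm_coord_le x i) (norm_nonneg ψ)
  have hl : ∀ ψ : Pre F, ∃ l : ℂ, ‖l‖ ≤ ‖x‖ * ‖ψ‖ ∧
      Filter.Tendsto (fun i => Pre.toDual F ψ (x i)) U (𝓝 l) := by
    intro ψ
    obtain ⟨l, hl, hl'⟩ := (isCompact_closedBall (0 : ℂ) (‖x‖ * ‖ψ‖)).ultrafilter_le_nhds
      (U.map fun i => Pre.toDual F ψ (x i)) (by
        rw [Filter.le_principal_iff]
        exact Filter.Eventually.of_forall (f := (U : Filter I)) fun i => by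
          simpa using hb ψ i)
    exact ⟨l, by simpa using hl, hl'⟩
  choose l hl1 hl2 using hl
  let g : StrongDual ℂ (Pre F) := LinearMap.mkContinuous
    { toFun := l
      map_add' := fun ψ ψ' => tendsto_nhds_unique (hl2 (ψ + ψ')) (by
        simpa using (hl2 ψ).add (hl2 ψ'))
      map_smul' := fun c ψ => tendsto_nhds_unique (hl2 (c • ψ)) (by
        simpa using (hl2 ψ).const_mul c) } ‖x‖ hl1
  obtain ⟨m, hm⟩ := hF.surjective g
  refine ⟨m, ?_, fun ψ hψ => ?_⟩
  · rw [← hF.isometry, hm]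
    exact LinearMap.mkContinuous_norm_le _ (norm_nonneg x) _
  · have h1 : l (⟨ψ, hψ⟩ : F) = ψ m := (DFunLike.congr_fun hm (⟨ψ, hψ⟩ : F)).symm
    rw [← h1]
    exact hl2 (⟨ψ, hψ⟩ : F)

/-- The weak* limit along an ultrafilter, as a linear contraction. -/
theorem IsPredual.exists_limit_map (hF : IsPredual F) (U : Ultrafilter I) :
    ∃ P : BoundedFamily I M →ₗ[ℂ] M, (∀ x, ‖P x‖ ≤ ‖x‖) ∧
      ∀ x, ∀ ψ ∈ F, Filter.Tendsto (fun i => ψ (x i)) U (𝓝 (ψ (P x))) := by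
  choose P hP1 hP2 using hF.exists_limit (I := I) U
  refine ⟨{ toFun := P, map_add' := fun x y => ?_, map_smul' := fun c x => ?_ }, hP1, hP2⟩
  · refine hF.ext fun ψ hψ => tendsto_nhds_unique (hP2 (x + y) ψ hψ) ?_
    simpa using (hP2 x ψ hψ).add (hP2 y ψ hψ)
  · refine hF.ext fun ψ hψ => tendsto_nhds_unique (hP2 (c • x) ψ hψ) ?_
    simpa using (hP2 x ψ hψ).const_mul c

theorem IsPredual.tendsto_mul_zero (hF : IsPredual F) {e : M} (he : ∀ x, e * x = x)
    (U : Ultrafilter I) {x : BoundedFamily I M}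
    (hx : ∀ ψ ∈ F, Filter.Tendsto (fun i => ψ (x i)) U (𝓝 0)) (a : M)
    {ψ : StrongDual ℂ M} (hψ : ψ ∈ F) : Filter.Tendsto (fun i => ψ (a * x i)) U (𝓝 0) := by
  obtain ⟨P, hP1, hP2⟩ := hF.exists_limit_map (I := I) U
  have hPc : ∀ m, P (BoundedFamily.const m) = m := fun m =>
    hF.ext fun ψ hψ => tendsto_nhds_unique (hP2 _ ψ hψ) tendsto_const_nhds
  let E : BoundedFamily I M →L[ℂ] BoundedFamily I M :=
    (BoundedFamily.const ∘ₗ P).mkContinuous 1 fun x => by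
      rw [one_mul]; exact (BoundedFamily.norm_const_le _).trans (hP1 x)
  have hE : ∀ y, E y = BoundedFamily.const (P y) := fun _ => rfl
  let N : Submodule ℂ (BoundedFamily I M) := LinearMap.eqLocus E.toLinearMap LinearMap.id
  have hNc : ∀ m, BoundedFamily.const m ∈ N := fun m => by
    change E _ = _
    rw [hE, hPc]; rfl
  have h := contractive_projection_mul (A := BoundedFamily I M) (e := BoundedFamily.const e)
    (fun x => lp.ext (funext fun i => he (x i))) (N := N)
    (isClosed_eq E.continuous continuous_id)
    (fun y hy z hz => by
      have hy' : BoundedFamily.const (P y) = y := hy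
      have hz' : BoundedFamily.const (P z) = z := hz
      rw [← hy', ← hz']
      exact hNc (P y * P z))
    (fun y hy => by
      have hy' : BoundedFamily.const (P y) = y := hy
      rw [← hy']
      exact hNc (star (P y)))
    (hNc e) (E := E) (fun y => (BoundedFamily.norm_const_le _).trans (hP1 y)) (fun y hy => hy)
    (hNc a) x
  have hPx : P x = 0 := hF.ext fun ψ hψ => by
    rw [map_zero]; exact tendsto_nhds_unique (hP2 x ψ hψ) (hx ψ hψ)
  have h2 := congrArg P h
  rw [hE, hE, hPc, hPx, map_zero, mul_zero, map_zero] at h2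
  have h3 := hP2 (BoundedFamily.const a * x) ψ hψ
  rwa [h2, map_zero] at h3

/-- The predual is invariant under the transposes of the multiplication operators. -/
theorem IsPredual.comp_jL_mem (hF : IsPredual F) {e : M} (he : ∀ x, e * x = x) (a : M)
    {ψ : StrongDual ℂ M} (hψ : ψ ∈ F) : ψ.comp (jL a) ∈ F := by
  by_contra hχ
  set χ := ψ.comp (jL a) with hχdef
  obtain ⟨ε, hε, hball⟩ := Metric.isOpen_iff.1 hF.isClosed.isOpen_compl χ hχ
  have key : ∀ s : Finset F, ∃ x : M, ‖x‖ ≤ 1 ∧ (∀ ψ ∈ s, (ψ : StrongDual ℂ M) x = 0) ∧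
      ε / 2 < ‖χ x‖ := by
    intro s
    by_contra! hcon
    let V : Submodule ℂ M := ⨅ ψ : s, LinearMap.ker (ψ.1.1 : M →ₗ[ℂ] ℂ)
    have hV : ∀ x ∈ V, ∀ ψ ∈ s, (ψ : StrongDual ℂ M) x = 0 := by
      intro x hx ψ hψ
      exact (Submodule.mem_iInf _).1 hx ⟨ψ, hψ⟩
    obtain ⟨g, hg1, hg2⟩ := exists_extension_norm_eq V (χ.comp V.subtypeL)
    have hg3 : ‖g‖ ≤ ε / 2 := by
      rw [hg2]
      refine ContinuousLinearMap.opNorm_le_of_unit_norm (by positivity) fun x hx => ?_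
      exact hcon x hx.le (hV x x.2)
    have hmem : χ - g ∈ F := by
      have h1 : ((χ - g : StrongDual ℂ M) : M →ₗ[ℂ] ℂ) ∈
          Submodule.span ℂ (Set.range fun ψ : s => (ψ.1.1 : M →ₗ[ℂ] ℂ)) := by
        refine mem_span_of_iInf_ker_le_ker fun x hx => ?_
        have := hg1 ⟨x, hx⟩
        simp at this
        simp [this]
      have h2 : Submodule.span ℂ (Set.range fun ψ : s => (ψ.1.1 : M →ₗ[ℂ] ℂ)) ≤
          F.map (ContinuousLinearMap.coeLM ℂ) := by
        rw [Submodule.span_le]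
        rintro _ ⟨ψ, rfl⟩
        exact ⟨ψ.1.1, ψ.1.2, rfl⟩
      obtain ⟨θ, hθ, hθ'⟩ := h2 h1
      rwa [← ContinuousLinearMap.coe_injective hθ']
    have : χ - g ∈ Metric.ball χ ε := by
      rw [Metric.mem_ball, dist_eq_norm, sub_sub_cancel_left, norm_neg]
      linarith
    exact hball this hmem
  choose x hx1 hx2 hx3 using key
  classical
  let U : Ultrafilter (Finset F) := Ultrafilter.of Filter.atTop
  have h := hF.tendsto_mul_zero he U (x := BoundedFamily.mk x 1 hx1) (fun ψ hψ => by
    refine tendsto_const_nhds.congr' (Filter.EventuallyEq.symm ?_)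
    have h1 : ∀ᶠ s in (Filter.atTop : Filter (Finset F)), {⟨ψ, hψ⟩} ≤ s :=
      Filter.eventually_ge_atTop _
    filter_upwards [Ultrafilter.of_le Filter.atTop h1] with s hs
    exact hx2 s ⟨ψ, hψ⟩ (Finset.singleton_subset_iff.1 hs)) a hψ
  have h2 := h.norm
  rw [norm_zero] at h2
  obtain ⟨s, hs⟩ := (h2.eventually_lt_const (half_pos hε)).exists
  exact lt_asymm hs (hx3 s)

end WeakStar

section Applications

variable {M : Type*} [JBStarAlgebra M] {F : Submodule ℂ (StrongDual ℂ M)} {φ : StrongDual ℂ M}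

theorem jtranslate_mem (hF : IsPredual F) (hφ : IsNormalFaithfulState F φ) (x : M) :
    jtranslate φ x ∈ F := by
  obtain ⟨e, he, -⟩ := exists_junit hF hφ
  exact hF.comp_jL_mem he x hφ.normal

/-- Unital Jordan *-homomorphisms are contractive. -/
theorem norm_starHom_le {A B : Type*} [JBStarAlgebra A] [JBStarAlgebra B] {e : A} {e' : B}
    (he : ∀ x, e * x = x) (he' : ∀ x, e' * x = x) (T : A →ₗ[ℂ] B)
    (hmul : ∀ x y, T (x * y) = T x * T y) (hstar : ∀ x, T (star x) = star (T x)) (hTe : T e = e')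
    (x : A) : ‖T x‖ ≤ ‖x‖ := by
  have hsa : ∀ {a}, IsSelfAdjoint a → IsSelfAdjoint (T a) := fun {a} ha => by
    rw [IsSelfAdjoint, ← hstar, ha.star_eq]
  have hpos : ∀ {a}, JPos a → JPos (T a) := by
    rintro _ ⟨s, hs, rfl⟩
    exact ⟨T s, hsa hs, (hmul s s).symm⟩
  have h1 : ∀ a, IsSelfAdjoint a → ‖T a‖ ≤ ‖a‖ := by
    intro a ha
    have h2 := hpos (jpos_sub_of_norm_le he ha le_rfl)
    have h3 := hpos (jpos_add_of_norm_le he ha le_rfl)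
    rw [map_sub, map_smul, hTe] at h2
    rw [map_add, map_smul, hTe] at h3
    exact norm_le_of_jpos he' (hsa ha) (norm_nonneg a) h2 h3
  refine norm_map_le_of_map_cube T 2 (fun x => ?_) (fun x => ?_) x
  · obtain ⟨u, v, hu, hv, huv, h2, h3, -⟩ := exists_re_im x
    have h4 : T x = T u + Complex.I • T v := by rw [huv, map_add, map_smul]
    rw [h4]
    refine (norm_add_le _ _).trans ?_
    rw [norm_smul, Complex.norm_I, one_mul]
    linarith [h1 u hu, h1 v hv]
  · simp only [map_sub, map_add, hmul, hstar]

theorem norm_starAlgEquiv_le (hF : IsPredual F) (hφ : IsNormalFaithfulState F φ)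
    (α : M ≃⋆ₐ[ℂ] M) (x : M) : ‖α x‖ ≤ ‖x‖ := by
  obtain ⟨e, he, -⟩ := exists_junit hF hφ
  have hαe : α e = e := by
    have h : ∀ y, α e * y = y := fun y => by
      obtain ⟨z, rfl⟩ := EquivLike.surjective α y
      rw [← map_mul, he]
    rw [← he (α e), mul_comm, h]
  let T : M →ₗ[ℂ] M := { toFun := α, map_add' := map_add α, map_smul' := map_smul α }
  exact norm_starHom_le he he T (map_mul α) (map_star α) hαe x

/-- A normal contractive projection that leaves a normal faithful state invariant is selfadjoint
with respect to it. -/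
theorem IsNormalContractiveProj.apply_mul (hF : IsPredual F) (hφ : IsNormalFaithfulState F φ)
    {N : JBWStarSubalgebra F} {E : M →L[ℂ] M} (hE : IsNormalContractiveProj F E N)
    (hφE : ∀ x, φ (E x) = φ x) {n : M} (hn : n ∈ N.toSub) (y : M) :
    φ (n * E y) = φ (n * y) := by
  obtain ⟨e, he, hφe⟩ := exists_junit hF hφ
  have hse := junit_isSelfAdjoint he
  have hmem : ∀ x, E x ∈ N.toSub := fun x => by
    have : E x ∈ Set.range E := ⟨x, rfl⟩
    rw [hE.range_eq] at this
    exact this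
  have hid : ∀ x ∈ N.toSub, E x = x := fun x hx => by
    have : x ∈ Set.range E := by rw [hE.range_eq]; exact hx
    obtain ⟨z, rfl⟩ := this
    exact hE.idem z
  have heN : e ∈ N.toSub := by
    obtain ⟨u, v, hu, hv, huv, hu1, -, hu'⟩ := exists_re_im (E e)
    have h1 : JPos (e - u) := by
      have := jpos_sub_of_norm_le he hu
        (hu1.trans ((hE.contractive e).trans (norm_junit_le he)))
      simpa using this
    have hv0 : (φ v).im = 0 :=
      state_im_eq_zero (ρ := φ.toLinearMap) he hφ.norm_apply_le hφe hv
    have h2 : (φ u).re = 1 := by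
      have := congrArg Complex.re (hφE e)
      rw [hφe, huv] at this
      simpa [hv0] using this
    have h3 : e - u = 0 := hφ.eq_zero h1 (by rw [map_sub, hφe]; simp [h2])
    rw [sub_eq_zero.1 h3, hu']
    exact N.toSub.smul_mem _ (add_mem (hmem e) (N.star_mem' (hmem e)))
  rw [← hφE (n * y), contractive_projection_mul he N.isClosed (fun x hx y hy => N.mul_mem' hx hy)
    (fun x hx => N.star_mem' hx) heN hE.contractive hid hn y]

end Applications

section Density

theorem exists_dual_ne_zero_of_notMem {X : Type*} [NormedAddCommGroup X] [NormedSpace ℂ X]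
    (S : Submodule ℂ X) (hS : IsClosed (S : Set X)) {x : X} (hx : x ∉ S) :
    ∃ g : StrongDual ℂ X, (∀ s ∈ S, g s = 0) ∧ g x ≠ 0 := by
  have : IsClosed (S : Set X) := hS
  have h0 : S.mkQL x ≠ 0 := fun h => hx ((Submodule.Quotient.mk_eq_zero S).1 h)
  obtain ⟨g, -, hg⟩ := exists_dual_vector ℂ (S.mkQL x) (norm_ne_zero_iff.2 h0)
  refine ⟨g.comp S.mkQL, fun s hs => ?_, ?_⟩
  · have : S.mkQL s = 0 := (Submodule.Quotient.mk_eq_zero S).2 hs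
    rw [ContinuousLinearMap.comp_apply, this, map_zero]
  · rw [ContinuousLinearMap.comp_apply, hg]
    simpa using h0

variable {M : Type*} [JBStarAlgebra M] {F : Submodule ℂ (StrongDual ℂ M)} {φ : StrongDual ℂ M}

theorem IsNormalFaithfulState.eq_zero_of_star_mul (hφ : IsNormalFaithfulState F φ) {m : M}
    (h : φ (star m * m) = 0) : m = 0 := by
  obtain ⟨u, v, hu, hv, rfl, -, -, -⟩ := exists_re_im m
  have h1 : star (u + Complex.I • v) * (u + Complex.I • v) = u * u + v * v := by
    rw [star_add, star_smul, hu.star_eq, hv.star_eq, add_mul, mul_add, mul_add, smul_mul_smul_comm,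
      mul_smul_comm, smul_mul_assoc, mul_comm v u]
    simp
  rw [h1, map_add] at h
  have h2 := congrArg Complex.re h
  rw [Complex.add_re, Complex.zero_re] at h2
  have hu0 := (hφ.nonneg u hu).1
  have hv0 := (hφ.nonneg v hv).1
  have h3 : u * u = 0 := hφ.eq_zero ⟨u, hu, rfl⟩ (by linarith)
  have h4 : v * v = 0 := hφ.eq_zero ⟨v, hv, rfl⟩ (by linarith)
  have h5 := norm_jmul_self hu
  have h6 := norm_jmul_self hv
  rw [h3] at h5
  rw [h4] at h6
  have h7 : u = 0 := by simpa using h5.symm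
  have h8 : v = 0 := by simpa using h6.symm
  simp [h7, h8]

/-- A closed set of functionals containing all `φ_x` contains the predual. -/
theorem predual_le_of_jtranslate_mem (hF : IsPredual F) (hφ : IsNormalFaithfulState F φ)
    {G : Submodule ℂ (StrongDual ℂ M)} (hG : IsClosed (G : Set (StrongDual ℂ M)))
    (h : ∀ x, jtranslate φ x ∈ G) : F ≤ G := by
  intro ψ hψ
  by_contra hcon
  let S : Submodule ℂ (Pre F) := G.comap (Pre.toDual F).toLinearMap
  have hS : IsClosed (S : Set (Pre F)) := hG.preimage (Pre.toDual F).continuous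
  have hnot : (⟨ψ, hψ⟩ : F) ∉ S := hcon
  obtain ⟨g, hg1, hg2⟩ := exists_dual_ne_zero_of_notMem S hS hnot
  obtain ⟨m, rfl⟩ := hF.surjective g
  have h1 : φ (star m * m) = 0 :=
    hg1 (⟨jtranslate φ (star m), jtranslate_mem hF hφ (star m)⟩ : F) (h (star m))
  rw [hφ.eq_zero_of_star_mul h1, map_zero] at hg2
  exact hg2 rfl

/-- A state preserving *-automorphism is normal. -/
theorem comp_starAlgEquiv_mem (hF : IsPredual F) (hφ : IsNormalFaithfulState F φ)
    {T : M →L[ℂ] M} (α : M ≃⋆ₐ[ℂ] M) (hT : ∀ x, T x = α x) (hα : ∀ x, φ (α x) = φ x)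
    {ψ : StrongDual ℂ M} (hψ : ψ ∈ F) : ψ.comp T ∈ F := by
  let R : StrongDual ℂ M →L[ℂ] StrongDual ℂ M := ContinuousLinearMap.precomp ℂ T
  refine predual_le_of_jtranslate_mem hF hφ (G := F.comap R.toLinearMap)
    (hF.isClosed.preimage R.continuous) (fun x => ?_) hψ
  have h : R (jtranslate φ x) = jtranslate φ (α.symm x) := by
    ext y
    change φ (x * T y) = φ (α.symm x * y)
    rw [hT, ← hα (α.symm x * y), map_mul α, StarAlgEquiv.apply_symm_apply]
  change R (jtranslate φ x) ∈ F
  rw [h]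
  exact jtranslate_mem hF hφ _

end Density

namespace NormedSub

variable {V V' : Type*} [AddCommGroup V] [Module ℂ V] [AddCommGroup V'] [Module ℂ V']

theorem val_injective (W : NormedSub V) : Function.Injective (val : W.Elem → V) :=
  Subtype.val_injective

/-- A linear map of the surrounding spaces is contractive from `W` to `W'` if it maps `W` to `W'`
and does not increase the norm. -/
def Contracts (W : NormedSub V) (W' : NormedSub V') (Φ : V →ₗ[ℂ] V') : Prop :=
  ∀ x : W.carrier, ∃ hx : Φ x ∈ W'.carrier, W'.nrm ⟨Φ x, hx⟩ ≤ W.nrm x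

/-- The contraction between normed subspaces induced by a contracting map. -/
noncomputable def Contracts.map {W : NormedSub V} {W' : NormedSub V'} {Φ : V →ₗ[ℂ] V'}
    (h : W.Contracts W' Φ) : W.Elem →L[ℂ] W'.Elem :=
  LinearMap.mkContinuous
    (Φ.restrict (p := W.carrier) (q := W'.carrier) fun x hx => (h ⟨x, hx⟩).1 :
      W.Elem →ₗ[ℂ] W'.Elem) 1 fun x => by
    rw [one_mul]; exact (h x).2

theorem Contracts.norm_map_le {W : NormedSub V} {W' : NormedSub V'} {Φ : V →ₗ[ℂ] V'}
    (h : W.Contracts W' Φ) (x : W.Elem) : ‖h.map x‖ ≤ ‖x‖ := (h x).2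

end NormedSub

namespace Interp

variable {X₀ X₁ V Y₀ Y₁ W : Type*} [NormedAddCommGroup X₀] [NormedSpace ℂ X₀]
  [NormedAddCommGroup X₁] [NormedSpace ℂ X₁] [NormedAddCommGroup V] [NormedSpace ℂ V]
  [NormedAddCommGroup Y₀] [NormedSpace ℂ Y₀]
  [NormedAddCommGroup Y₁] [NormedSpace ℂ Y₁] [NormedAddCommGroup W] [NormedSpace ℂ W]
  {j₀ : X₀ →L[ℂ] V} {j₁ : X₁ →L[ℂ] V} {k₀ : Y₀ →L[ℂ] W} {k₁ : Y₁ →L[ℂ] W}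

theorem inl_eq_inr {x₀ : X₀} {x₁ : X₁} (h : j₀ x₀ = j₁ x₁) : inl j₀ j₁ x₀ = inr j₀ j₁ x₁ := by
  refine (Submodule.Quotient.eq _).2 ?_
  simp [sumMap, h]

/-- The map of sums induced by a morphism of couples. -/
noncomputable def mapSum (T₀ : X₀ →L[ℂ] Y₀) (T₁ : X₁ →L[ℂ] Y₁)
    (hT : ∀ x₀ x₁, j₀ x₀ + j₁ x₁ = 0 → k₀ (T₀ x₀) + k₁ (T₁ x₁) = 0) :
    Sum j₀ j₁ →L[ℂ] Sum k₀ k₁ :=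
  (sumMap j₀ j₁).ker.liftQL
    ((sumMap k₀ k₁).ker.mkQL ∘L
      (WithLp.prodContinuousLinearEquiv 1 ℂ Y₀ Y₁).symm.toContinuousLinearMap ∘L
      (T₀.prodMap T₁) ∘L (WithLp.prodContinuousLinearEquiv 1 ℂ X₀ X₁).toContinuousLinearMap) (by
    intro x hx
    refine (Submodule.Quotient.mk_eq_zero _).2 ?_
    exact hT x.fst x.snd hx)

variable {T₀ : X₀ →L[ℂ] Y₀} {T₁ : X₁ →L[ℂ] Y₁}
  {hT : ∀ x₀ x₁, j₀ x₀ + j₁ x₁ = 0 → k₀ (T₀ x₀) + k₁ (T₁ x₁) = 0}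

theorem mapSum_inl (x : X₀) : mapSum T₀ T₁ hT (inl j₀ j₁ x) = inl k₀ k₁ (T₀ x) := by
  change (sumMap k₀ k₁).ker.mkQ (WithLp.toLp 1 (T₀ x, T₁ 0)) = _
  rw [map_zero]
  rfl

theorem mapSum_inr (x : X₁) : mapSum T₀ T₁ hT (inr j₀ j₁ x) = inr k₀ k₁ (T₁ x) := by
  change (sumMap k₀ k₁).ker.mkQ (WithLp.toLp 1 (T₀ 0, T₁ x)) = _
  rw [map_zero]
  rfl

theorem exists_inl_add_inr (x : Sum j₀ j₁) : ∃ x₀ x₁, x = inl j₀ j₁ x₀ + inr j₀ j₁ x₁ := by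
  obtain ⟨y, rfl⟩ := Submodule.Quotient.mk_surjective _ x
  refine ⟨y.fst, y.snd, ?_⟩
  change (sumMap j₀ j₁).ker.mkQ y = (sumMap j₀ j₁).ker.mkQ (WithLp.toLp 1 (y.fst, 0)) +
    (sumMap j₀ j₁).ker.mkQ (WithLp.toLp 1 (0, y.snd))
  rw [← map_add, ← WithLp.toLp_add, Prod.mk_add_mk, add_zero, zero_add]
  rfl

/-- Composition of a function vanishing at infinity with a linear map. -/
def mapZeroAtInfty (T : X₀ →L[ℂ] Y₀) (g : C₀(ℝ, X₀)) : C₀(ℝ, Y₀) where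
  toFun t := T (g t)
  continuous_toFun := T.continuous.comp g.continuous
  zero_at_infty' := by
    have := (T.continuous.tendsto 0).comp g.zero_at_infty'
    rwa [map_zero] at this

theorem norm_mapZeroAtInfty_le (hT : ∀ x, ‖T₀ x‖ ≤ ‖x‖) (g : C₀(ℝ, X₀)) :
    ‖mapZeroAtInfty T₀ g‖ ≤ ‖g‖ := by
  rw [← ZeroAtInftyContinuousMap.norm_toBCF_eq_norm, ← ZeroAtInftyContinuousMap.norm_toBCF_eq_norm]
  exact (BoundedContinuousFunction.norm_le (norm_nonneg _)).2 fun t =>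
    (hT _).trans (g.toBCF.norm_coe_le_norm t)

theorem IsAdmissible.map {f : ℂ → Sum j₀ j₁} {g₀ : C₀(ℝ, X₀)} {g₁ : C₀(ℝ, X₁)}
    (h : IsAdmissible j₀ j₁ f g₀ g₁) :
    IsAdmissible k₀ k₁ (fun z => mapSum T₀ T₁ hT (f z)) (mapZeroAtInfty T₀ g₀)
      (mapZeroAtInfty T₁ g₁) where
  continuousOn := (mapSum T₀ T₁ hT).continuous.comp_continuousOn h.continuousOn
  bounded := by
    obtain ⟨C, hC⟩ := h.bounded
    exact ⟨‖mapSum T₀ T₁ hT‖ * C, fun z hz => ((mapSum T₀ T₁ hT).le_opNorm _).trans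
      (mul_le_mul_of_nonneg_left (hC z hz) (norm_nonneg _))⟩
  holomorphic := (mapSum T₀ T₁ hT).differentiable.comp_differentiableOn h.holomorphic
  left t := by rw [h.left, mapSum_inl]; rfl
  right t := by rw [h.right, mapSum_inr]; rfl

theorem contracts_interp (h₀ : ∀ x, ‖T₀ x‖ ≤ ‖x‖) (h₁ : ∀ x, ‖T₁ x‖ ≤ ‖x‖) (θ : unitInterval) :
    (interp j₀ j₁ θ).Contracts (interp k₀ k₁ θ) (mapSum T₀ T₁ hT).toLinearMap := by
  rintro ⟨x, hx⟩
  have hx' : mapSum T₀ T₁ hT x ∈ space k₀ k₁ θ := by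
    obtain ⟨f, g₀, g₁, h, rfl⟩ := hx
    exact ⟨_, _, _, h.map, rfl⟩
  refine ⟨hx', ?_⟩
  change sInf (norms θ (mapSum T₀ T₁ hT x)) ≤ sInf (norms θ x)
  refine le_csInf (norms_nonempty hx) ?_
  rintro _ ⟨f, g₀, g₁, h, rfl, rfl⟩
  refine (csInf_le (norms_bddBelow _ _) ⟨_, _, _, h.map, rfl, rfl⟩).trans ?_
  exact max_le_max (norm_mapZeroAtInfty_le h₀ g₀) (norm_mapZeroAtInfty_le h₁ g₁)

theorem contracts_right (h₁ : ∀ x, ‖T₁ x‖ ≤ ‖x‖) (hj : Function.Injective j₁)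
    (hk : Function.Injective k₁) :
    (right j₀ j₁ hj).Contracts (right k₀ k₁ hk) (mapSum T₀ T₁ hT).toLinearMap := by
  rintro ⟨_, x, rfl⟩
  refine ⟨⟨T₁ x, (mapSum_inr x).symm⟩, ?_⟩
  have e1 : (LinearEquiv.ofInjective (inr j₀ j₁) (inr_injective hj)).symm
      ⟨inr j₀ j₁ x, ⟨x, rfl⟩⟩ = x := by
    rw [LinearEquiv.symm_apply_eq]; rfl
  have e2 : ∀ h, (LinearEquiv.ofInjective (inr k₀ k₁) (inr_injective hk)).symm
      ⟨mapSum T₀ T₁ hT (inr j₀ j₁ x), h⟩ = T₁ x := by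
    intro h
    rw [LinearEquiv.symm_apply_eq]
    exact Subtype.ext (mapSum_inr x)
  exact (congrArg norm (e2 _)).trans_le ((h₁ x).trans_eq (congrArg norm e1).symm)

theorem norm_cexp_sq_sub (z : ℂ) (θ : ℝ) :
    ‖Complex.exp (z ^ 2 - (θ : ℂ) ^ 2)‖ = Real.exp (z.re ^ 2 - z.im ^ 2 - θ ^ 2) := by
  rw [Complex.norm_exp]
  congr 1
  simp [pow_two]

/-- The function `t ↦ exp ((a + i t)² - θ²) x` vanishes at infinity. -/
noncomputable def gaussian (a θ : ℝ) (x : X₀) : C₀(ℝ, X₀) where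
  toFun t := Complex.exp ((a + t * Complex.I) ^ 2 - (θ : ℂ) ^ 2) • x
  continuous_toFun := by fun_prop
  zero_at_infty' := by
    rw [tendsto_zero_iff_norm_tendsto_zero]
    have h1 : Filter.Tendsto (fun t : ℝ => ‖t‖ ^ 2) (Filter.cocompact ℝ) Filter.atTop :=
      (Filter.tendsto_pow_atTop two_ne_zero).comp tendsto_norm_cocompact_atTop
    have h2 : Filter.Tendsto (fun t : ℝ => Real.exp (a ^ 2 - θ ^ 2 + -‖t‖ ^ 2) * ‖x‖)
        (Filter.cocompact ℝ) (𝓝 (0 * ‖x‖)) :=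
      (Real.tendsto_exp_atBot.comp
        (tendsto_const_nhds.add_atBot (Filter.tendsto_neg_atTop_atBot.comp h1))).mul_const _
    rw [zero_mul] at h2
    refine h2.congr fun t => ?_
    rw [norm_smul, norm_cexp_sq_sub]
    congr 2
    simp
    ring

/-- The intersection of a couple is contained in the interpolation spaces. -/
theorem inl_mem_space {x₀ : X₀} {x₁ : X₁} (h : j₀ x₀ = j₁ x₁) (θ : unitInterval) :
    inl j₀ j₁ x₀ ∈ space j₀ j₁ θ := by
  refine ⟨fun z => Complex.exp (z ^ 2 - ((θ : ℝ) : ℂ) ^ 2) • inl j₀ j₁ x₀, gaussian 0 θ x₀,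
    gaussian 1 θ x₁, ⟨?_, ?_, ?_, ?_, ?_⟩, by simp⟩
  · fun_prop
  · refine ⟨Real.exp 1 * ‖inl j₀ j₁ x₀‖, fun z hz => ?_⟩
    rw [norm_smul, norm_cexp_sq_sub]
    gcongr
    nlinarith [sq_nonneg z.im, sq_nonneg (θ : ℝ), hz.1, hz.2]
  · fun_prop
  · intro t
    rw [← map_smul]
    congr 1
    simp [gaussian]
  · intro t
    rw [inl_eq_inr h, ← map_smul]
    congr 1

end Interp

section LpMaps

variable {M M' : Type*} [JBStarAlgebra M] [JBStarAlgebra M'] {F : Submodule ℂ (StrongDual ℂ M)}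
  {F' : Submodule ℂ (StrongDual ℂ M')} {φ : StrongDual ℂ M} {φ' : StrongDual ℂ M'}

theorem contracts_LpSub {T₀ : M →L[ℂ] M'} {T₁ : Pre F →L[ℂ] Pre F'} (h₀ : ∀ x, ‖T₀ x‖ ≤ ‖x‖)
    (h₁ : ∀ x, ‖T₁ x‖ ≤ ‖x‖)
    (hT : ∀ x₀ x₁, jtranslate φ x₀ + Pre.toDual F x₁ = 0 →
      jtranslate φ' (T₀ x₀) + Pre.toDual F' (T₁ x₁) = 0) (p : ℝ) (hp : 1 ≤ p) :
    (LpSub F φ p hp).Contracts (LpSub F' φ' p hp) (Interp.mapSum T₀ T₁ hT).toLinearMap := by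
  unfold LpSub
  split_ifs
  · exact Interp.contracts_right h₁ _ _
  · exact Interp.contracts_interp h₀ h₁ _

theorem ofAlg_mem (hF : IsPredual F) (hφ : IsNormalFaithfulState F φ) (p : ℝ) (hp : 1 ≤ p)
    (x : M) : ofAlg F φ x ∈ (LpSub F φ p hp).carrier := by
  have h : jtranslate φ x = Pre.toDual F (⟨jtranslate φ x, jtranslate_mem hF hφ x⟩ : F) := rfl
  unfold LpSub
  split_ifs
  · exact ⟨_, (Interp.inl_eq_inr h).symm⟩
  · exact Interp.inl_mem_space h _

/-- Restriction of the transpose of a contraction to preduals. -/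
noncomputable def preComp (T : M' →L[ℂ] M) (hT : ∀ ψ ∈ F, ψ.comp T ∈ F') : Pre F →L[ℂ] Pre F' :=
  LinearMap.mkContinuous
    ((ContinuousLinearMap.precomp ℂ T).toLinearMap.restrict (p := F) (q := F') hT :
      Pre F →ₗ[ℂ] Pre F') ‖T‖ fun ψ => by
    rw [mul_comm]
    exact ContinuousLinearMap.opNorm_comp_le (Pre.toDual F ψ) T

theorem norm_preComp_le {T : M' →L[ℂ] M} {hT : ∀ ψ ∈ F, ψ.comp T ∈ F'} (h : ∀ x, ‖T x‖ ≤ ‖x‖)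
    (ψ : Pre F) : ‖preComp T hT ψ‖ ≤ ‖ψ‖ := by
  refine (ContinuousLinearMap.opNorm_comp_le (Pre.toDual F ψ) T).trans ?_
  exact mul_le_of_le_one_right (norm_nonneg _)
    (ContinuousLinearMap.opNorm_le_bound _ zero_le_one fun x => by simpa using h x)

end LpMaps

namespace NormedSub

variable {V V' : Type*} [AddCommGroup V] [Module ℂ V] [AddCommGroup V'] [Module ℂ V']
  {W : NormedSub V} {W' : NormedSub V'} {Φ : V →ₗ[ℂ] V'} {Ψ : V' →ₗ[ℂ] V}

theorem Contracts.map_map (h : W.Contracts W' Φ) (h' : W'.Contracts W Ψ) (hΨ : ∀ x, Ψ (Φ x) = x)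
    (x : W.Elem) : h'.map (h.map x) = x :=
  W.val_injective (hΨ x.val)

theorem Contracts.norm_map (h : W.Contracts W' Φ) (h' : W'.Contracts W Ψ) (hΨ : ∀ x, Ψ (Φ x) = x)
    (x : W.Elem) : ‖h.map x‖ = ‖x‖ :=
  le_antisymm (h.norm_map_le x) (by simpa [h.map_map h' hΨ] using h'.norm_map_le (h.map x))

/-- Mutually inverse contracting maps induce an isometric isomorphism. -/
noncomputable def Contracts.isometryEquiv (h : W.Contracts W' Φ) (h' : W'.Contracts W Ψ)
    (hΨ : ∀ x, Ψ (Φ x) = x) (hΦ : ∀ x, Φ (Ψ x) = x) : W.Elem ≃ₗᵢ[ℂ] W'.Elem where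
  toLinearMap := h.map.toLinearMap
  invFun := h'.map
  left_inv := h.map_map h' hΨ
  right_inv := h'.map_map h hΦ
  norm_map' := h.norm_map h' hΨ

theorem Contracts.nonempty_isometryEquiv_range (h : W.Contracts W' Φ) (h' : W'.Contracts W Ψ)
    (hΨ : ∀ x, Ψ (Φ x) = x) : Nonempty (W.Elem ≃ₗᵢ[ℂ] (h.map.comp h'.map).range) := by
  let li : W.Elem →ₗᵢ[ℂ] W'.Elem := ⟨h.map.toLinearMap, h.norm_map h' hΨ⟩
  have heq : LinearMap.range li.toLinearMap = (h.map.comp h'.map).range := by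
    ext y
    constructor
    · rintro ⟨x, rfl⟩
      exact ⟨h.map x, congrArg h.map (h.map_map h' hΨ x)⟩
    · rintro ⟨x, rfl⟩
      exact ⟨h'.map x, rfl⟩
  rw [← heq]
  exact ⟨li.equivRange⟩

end NormedSub

theorem Interp.mapSum_mapSum {X₀ X₁ V Y₀ Y₁ W : Type*} [NormedAddCommGroup X₀] [NormedSpace ℂ X₀]
    [NormedAddCommGroup X₁] [NormedSpace ℂ X₁] [NormedAddCommGroup V] [NormedSpace ℂ V]
    [NormedAddCommGroup Y₀] [NormedSpace ℂ Y₀]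
    [NormedAddCommGroup Y₁] [NormedSpace ℂ Y₁] [NormedAddCommGroup W] [NormedSpace ℂ W]
    {j₀ : X₀ →L[ℂ] V} {j₁ : X₁ →L[ℂ] V} {k₀ : Y₀ →L[ℂ] W} {k₁ : Y₁ →L[ℂ] W}
    {T₀ : X₀ →L[ℂ] Y₀} {T₁ : X₁ →L[ℂ] Y₁} {S₀ : Y₀ →L[ℂ] X₀} {S₁ : Y₁ →L[ℂ] X₁}
    {hT : ∀ x₀ x₁, j₀ x₀ + j₁ x₁ = 0 → k₀ (T₀ x₀) + k₁ (T₁ x₁) = 0}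
    {hS : ∀ y₀ y₁, k₀ y₀ + k₁ y₁ = 0 → j₀ (S₀ y₀) + j₁ (S₁ y₁) = 0}
    (h₀ : ∀ x, S₀ (T₀ x) = x) (h₁ : ∀ x, S₁ (T₁ x) = x) (x : Interp.Sum j₀ j₁) :
    Interp.mapSum S₀ S₁ hS (Interp.mapSum T₀ T₁ hT x) = x := by
  obtain ⟨x₀, x₁, rfl⟩ := Interp.exists_inl_add_inr x
  rw [map_add, map_add, Interp.mapSum_inl, Interp.mapSum_inr, Interp.mapSum_inl, Interp.mapSum_inr,
    h₀, h₁]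

section Main

variable {M : Type*} [JBStarAlgebra M] {F : Submodule ℂ (StrongDual ℂ M)} {φ : StrongDual ℂ M}

/-- State preserving *-automorphisms act isometrically on the spaces `L^p`. -/
theorem exists_isometryEquiv_of_automorphism (hF : IsPredual F) (hφ : IsNormalFaithfulState F φ)
    (α : M ≃⋆ₐ[ℂ] M) (hα : ∀ x, φ (α x) = φ x) (p : ℝ) (hp : 1 ≤ p) :
    ∃ αp : JLp F φ p hp ≃ₗᵢ[ℂ] JLp F φ p hp, Induces F φ p hp α αp := by
  let T : (M ≃⋆ₐ[ℂ] M) → (M →L[ℂ] M) := fun β => LinearMap.mkContinuous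
    { toFun := β, map_add' := map_add β, map_smul' := map_smul β } 1 fun x => by
      rw [one_mul]; exact norm_starAlgEquiv_le hF hφ β x
  have hT : ∀ β x, T β x = β x := fun _ _ => rfl
  have hTn : ∀ β x, ‖T β x‖ ≤ ‖x‖ := fun β x => norm_starAlgEquiv_le hF hφ β x
  have hα' : ∀ x, φ (α.symm x) = φ x := fun x => by
    rw [← hα, StarAlgEquiv.apply_symm_apply]
  have hm : ∀ β : M ≃⋆ₐ[ℂ] M, (∀ x, φ (β x) = φ x) → ∀ ψ ∈ F, ψ.comp (T β) ∈ F :=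
    fun β hβ ψ hψ => comp_starAlgEquiv_mem hF hφ β (hT β) hβ hψ
  have hc : ∀ β γ : M ≃⋆ₐ[ℂ] M, (∀ x, β (γ x) = x) → (∀ x, φ (β x) = φ x) →
      ∀ hγ : (∀ ψ ∈ F, ψ.comp (T γ) ∈ F), ∀ x₀ x₁, jtranslate φ x₀ + Pre.toDual F x₁ = 0 →
      jtranslate φ (T β x₀) + Pre.toDual F (preComp (T γ) hγ x₁) = 0 := by
    intro β γ hβγ hβ hγ x₀ x₁ h
    ext y
    have h1 := DFunLike.congr_fun h (γ y)
    change φ (β x₀ * y) + Pre.toDual F x₁ (γ y) = 0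
    have h2 : φ (β x₀ * y) = φ (x₀ * γ y) := by rw [← hβ (x₀ * γ y), map_mul β, hβγ]
    rw [h2]
    exact h1
  have h1 := contracts_LpSub (hTn α) (norm_preComp_le (hTn α.symm))
    (hc α α.symm α.apply_symm_apply hα (hm _ hα')) p hp
  have h2 := contracts_LpSub (hTn α.symm) (norm_preComp_le (hTn α))
    (hc α.symm α α.symm_apply_apply hα' (hm _ hα)) p hp
  refine ⟨h1.isometryEquiv h2
    (Interp.mapSum_mapSum α.symm_apply_apply fun ψ => Pre.toDual_injective F ?_)
    (Interp.mapSum_mapSum α.apply_symm_apply fun ψ => Pre.toDual_injective F ?_), fun x => ?_⟩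
  · ext y
    exact congrArg (Pre.toDual F ψ) (α.symm_apply_apply y)
  · ext y
    exact congrArg (Pre.toDual F ψ) (α.apply_symm_apply y)
  · refine ⟨⟨ofAlg F φ x, ofAlg_mem hF hφ p hp x⟩, rfl, ?_⟩
    change Interp.mapSum (T α) (preComp (T α.symm) (hm _ hα'))
      (hc α α.symm α.apply_symm_apply hα (hm _ hα')) (Interp.inl _ _ x) = _
    rw [Interp.mapSum_inl]
    rfl

/-- State preserving normal contractive projections act on the spaces `L^p`, the range being the
`L^p`-space of the range. -/
theorem exists_projection (hF : IsPredual F) (hφ : IsNormalFaithfulState F φ)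
    (N : JBWStarSubalgebra F) (E : M →L[ℂ] M) (hE : IsNormalContractiveProj F E N)
    (hφE : ∀ x, φ (E x) = φ x) (p : ℝ) (hp : 1 ≤ p) :
    ∃ Ep : JLp F φ p hp →L[ℂ] JLp F φ p hp, Induces F φ p hp E Ep ∧ (∀ h, Ep (Ep h) = Ep h) ∧
      Nonempty (JLp N.predual (φ.comp N.incl) p hp ≃ₗᵢ[ℂ] Ep.range) := by
  have hmem : ∀ x, E x ∈ N.toSub := fun x => by
    have : E x ∈ Set.range E := ⟨x, rfl⟩
    rw [hE.range_eq] at this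
    exact this
  have hid : ∀ x ∈ N.toSub, E x = x := fun x hx => by
    have : x ∈ Set.range E := by rw [hE.range_eq]; exact hx
    obtain ⟨z, rfl⟩ := this
    exact hE.idem z
  have hmul := fun {n : M} (hn : n ∈ N.toSub) (y : M) =>
    hE.apply_mul hF hφ hφE hn y
  let R : M →L[ℂ] N.Elem := E.codRestrict N.toSub hmem
  have hRn : ∀ x, ‖R x‖ ≤ ‖x‖ := hE.contractive
  have hIn : ∀ x, ‖N.incl x‖ ≤ ‖x‖ := fun x => le_rfl
  have hI : ∀ ψ ∈ F, ψ.comp N.incl ∈ N.predual := fun ψ hψ => ⟨ψ, hψ, rfl⟩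
  have hR : ∀ ρ ∈ N.predual, ρ.comp R ∈ F := by
    rintro _ ⟨ψ, hψ, rfl⟩
    exact hE.normal ψ hψ
  have hRI : ∀ n : N.Elem, R (N.incl n) = n := fun n => Subtype.ext (hid n n.2)
  have hi : ∀ (x₀ : N.Elem) (x₁ : Pre N.predual),
      jtranslate (φ.comp N.incl) x₀ + Pre.toDual N.predual x₁ = 0 →
      jtranslate φ (N.incl x₀) + Pre.toDual F (preComp R hR x₁) = 0 := by
    intro x₀ x₁ h
    ext y
    have h1 : φ ((x₀ : M) * E y) + Pre.toDual N.predual x₁ (R y) = 0 := DFunLike.congr_fun h (R y)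
    rw [hmul x₀.2] at h1
    exact h1
  have hr : ∀ (x₀ : M) (x₁ : Pre F), jtranslate φ x₀ + Pre.toDual F x₁ = 0 →
      jtranslate (φ.comp N.incl) (R x₀) + Pre.toDual N.predual (preComp N.incl hI x₁) = 0 := by
    intro x₀ x₁ h
    ext n
    have h1 : φ (x₀ * (n : M)) + Pre.toDual F x₁ (n : M) = 0 := DFunLike.congr_fun h (n : M)
    rw [mul_comm, ← hmul n.2, mul_comm] at h1
    exact h1
  have h1 := contracts_LpSub hIn (norm_preComp_le hRn) hi p hp
  have h2 := contracts_LpSub hRn (norm_preComp_le hIn) hr p hp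
  have hΨ : ∀ x, Interp.mapSum R (preComp N.incl hI) hr
      (Interp.mapSum N.incl (preComp R hR) hi x) = x :=
    Interp.mapSum_mapSum hRI fun ψ => Pre.toDual_injective _ (by
      ext n
      exact congrArg (Pre.toDual N.predual ψ) (hRI n))
  refine ⟨h1.map.comp h2.map, fun x => ?_, fun h => ?_, h1.nonempty_isometryEquiv_range h2 hΨ⟩
  · refine ⟨⟨ofAlg F φ x, ofAlg_mem hF hφ p hp x⟩, rfl, ?_⟩
    change Interp.mapSum N.incl (preComp R hR) hi (Interp.mapSum R (preComp N.incl hI) hr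
      (Interp.inl _ _ x)) = _
    rw [Interp.mapSum_inl, Interp.mapSum_inl]
    rfl
  · exact congrArg h1.map (h1.map_map h2 hΨ _)

end Main

theorem mainTheorem8 {M : Type*} [JBStarAlgebra M]
    (F : Submodule ℂ (StrongDual ℂ M)) (hF : IsPredual F)
    (φ : StrongDual ℂ M) (hφ : IsNormalFaithfulState F φ) :
    (∀ α : M ≃⋆ₐ[ℂ] M, (∀ x, φ (α x) = φ x) →
      ∀ (p : ℝ) (hp : 1 ≤ p), ∃ αp : JLp F φ p hp ≃ₗᵢ[ℂ] JLp F φ p hp,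
        Induces F φ p hp α αp) ∧
    (∀ (N : JBWStarSubalgebra F) (E : M →L[ℂ] M), IsNormalContractiveProj F E N →
      (∀ x, φ (E x) = φ x) →
      ∀ (p : ℝ) (hp : 1 ≤ p), ∃ Ep : JLp F φ p hp →L[ℂ] JLp F φ p hp,
        Induces F φ p hp E Ep ∧ (∀ h, Ep (Ep h) = Ep h) ∧
        Nonempty (JLp N.predual (φ.comp N.incl) p hp ≃ₗᵢ[ℂ] Ep.range)) :=
  ⟨exists_isometryEquiv_of_automorphism hF hφ, exists_projection hF hφ⟩
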